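/- **Setting.** Let $\mathrm L:\mathcal S'(\mathbb R)\to\mathcal S'(\mathbb R)$ be a continuous linear operator that maps real tempered distributions to real ones and is *spline-admissible*: it is shift-invariant, it has a real Green's function $\rho_{\mathrm L}\in\mathcal S'(\mathbb R)$ with $\mathrm L\rho_{\mathrm L}=\delta$, and, with the search space $$\mathcal X_2=\{f\in\mathcal S'(\mathbb R)\text{ real}:\ \|\mathrm Lf\|_{L_2}<\infty\},$$ its null space $\mathcal N_{\mathrm L}=\{p\in\mathcal X_2:\mathrm Lp=0\}$ is finite-dimensional, with basis $p_1,\dots,p_{N_0}$. Let $\widehat{\mathrm L}$ be the frequency response of $\mathrm L$ (so $\mathrm L\{e^{2\pi i\xi\cdot}\}=\widehat{\mathrm L}(\xi)e^{2\pi i\xi\cdot}$ for all $\xi\in\mathbb R$; $\widehat f$ or $\mathcal F f$ denotes the Fourier transform in the same normalization), $\mathrm L^*$ the adjoint of $\mathrm L$ (the shift-invariant operator with frequency response $\overline{\widehat{\mathrm L}}$), and let $\rho\in\mathcal S'(\mathbb R)$ be a real Green's function of $\mathrm L^*\mathrm L$, i.e. $\mathrm L^*\mathrm L\rho=\delta$.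 Let $\mathrm H:\mathcal X_2\to\mathbb R^M$, $\mathrm H\{f\}=(\langle h_1,f\rangle,\dots,\langle h_M,f\rangle)$, be linear and bounded for the norm $\big(\|\mathrm Lf\|_{L_2}^2+\sum_n\langle\kappa_n,f\rangle^2\big)^{1/2}$, where $\kappa_1,\dots,\kappa_{N_0}$ are real Schwartz functions with $\langle\kappa_j,p_i\rangle=\delta_{ij}$; here the $h_m$ are tempered distributions, and $\langle h_m,\cdot\rangle$ also denotes the extension to $\mathcal X_2$ of the pairing of $h_m$ with real Schwartz functions. Assume that $\mathrm H\{p\}=\mathrm H\{q\}\Leftrightarrow p=q$ for $p,q\in\mathcal N_{\mathrm L}$. Let $\lambda>0$, $\mathbf z\in\mathbb R^M$ and $E:\mathbb R^M\times\mathbb R^M\to[0,\infty]$ be such that $E(\mathbf z,\cdot)$ is convex, lower semicontinuous and coercive ($E(\mathbf z,\mathbf u)\to\infty$ as $\|\mathbf u\|\to\infty$), and $E(\mathbf z,\mathrm H\{f\})<\infty$ for at least one $f\in\mathcal X_2$. **Basis functions.** For each $m$ there is a real $\varphi_m\in\mathcal S'(\mathbb R)$, $$\varphi_m=\mathcal F^{-1}\Big\{\frac{\widehat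 h_m}{|\widehat{\mathrm L}|^2}\Big\}=(\mathrm L^*\mathrm L)^{-1}h_m=\rho*h_m ,$$ which means: $|\widehat{\mathrm L}|^2\,\widehat\varphi_m=\widehat h_m$ and $\mathrm L^*\mathrm L\varphi_m=h_m$, and, for every real Schwartz function $\psi$ with $\langle p,\psi\rangle=0$ for all $p\in\mathcal N_{\mathrm L}$, the function $\rho^\vee*\psi=\int_{\mathbb R}\rho(x-\cdot)\psi(x)\,\mathrm dx$ lies in $\mathcal X_2$ and $\langle\varphi_m,\psi\rangle=\langle h_m,\rho^\vee*\psi\rangle$. (This determines $\varphi_m$ up to an element of $\mathcal N_{\mathrm L}$.) **Theorem.** The functional $$J(f)=E(\mathbf z,\mathrm H\{f\})+\lambda\|\mathrm Lf\|_{L_2}^2$$ has a minimizer over $\mathcal X_2$; if $E(\mathbf z,\cdot)$ is strictly convex on its effective domain $\{\mathbf u : E(\mathbf z,\mathbf u)<\infty\}$, the minimizer is unique. For every choice of the $\varphi_m$ as above, every minimizer $f_2$ has the form $$f_2=\sum_{m=1}^M a_m\varphi_m+\sum_{n=1}^{N_0}b_np_n,\qquad a_m,b_n\in\mathbb R,$$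 with coefficients such that $\sum_{m=1}^M a_m\langle h_m,p_n\rangle=0$ for every $n\in\{1,\dots,N_0\}$. -/

import Mathlib

open scoped SchwartzMap FourierTransform ENNReal

noncomputable section

namespace Tikhonov

open MeasureTheory Filter Topology

/-- A Schwartz function is real-valued. -/
def IsRealTest (ψ : 𝓢(ℝ, ℂ)) : Prop := ∀ x, (ψ x).im = 0

/-- A tempered distribution is real: it takes real values on real-valued Schwartz functions. -/
def IsReal (f : 𝓢'(ℝ, ℂ)) : Prop := ∀ ψ : 𝓢(ℝ, ℂ), IsRealTest ψ → (f ψ).im = 0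

/-- The shift `f ↦ f(· - t)` on tempered distributions: `⟨f(· - t), ψ⟩ = ⟨f, ψ(· + t)⟩`. -/
def shift (t : ℝ) : 𝓢'(ℝ, ℂ) →L[ℂ] 𝓢'(ℝ, ℂ) :=
  PointwiseConvergenceCLM.precomp ℂ (SchwartzMap.compSubConstCLM ℂ (-t))

/-- The reflection `f ↦ f(-·)` on tempered distributions. -/
def reflect : 𝓢'(ℝ, ℂ) →L[ℂ] 𝓢'(ℝ, ℂ) :=
  PointwiseConvergenceCLM.precomp ℂ
    (SchwartzMap.compCLMOfContinuousLinearEquiv ℂ (ContinuousLinearEquiv.neg ℝ))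

theorem shift_apply (t : ℝ) (f : 𝓢'(ℝ, ℂ)) (ψ : 𝓢(ℝ, ℂ)) :
    shift t f ψ = f (SchwartzMap.compSubConstCLM ℂ (-t) ψ) := rfl

theorem reflect_apply (f : 𝓢'(ℝ, ℂ)) (ψ : 𝓢(ℝ, ℂ)) :
    reflect f ψ =
      f (SchwartzMap.compCLMOfContinuousLinearEquiv ℂ (ContinuousLinearEquiv.neg ℝ) ψ) := rfl

/-- The complex exponential `x ↦ e^{2πiξx}`, as a tempered distribution. -/
def cexp (ξ : ℝ) : 𝓢'(ℝ, ℂ) := 𝓕⁻ (TemperedDistribution.delta ξ)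

theorem cexp_apply (ξ : ℝ) (ψ : 𝓢(ℝ, ℂ)) :
    cexp ξ ψ = ∫ x : ℝ, Complex.exp (2 * Real.pi * Complex.I * ξ * x) * ψ x := by
  change (𝓕⁻ ψ) ξ = _
  rw [SchwartzMap.fourierInv_coe, Real.fourierInv_eq]
  refine integral_congr_ae (Eventually.of_forall fun x => ?_)
  simp only [Circle.smul_def, Real.fourierChar_apply, smul_eq_mul]
  congr 2
  simp
  ring

/-- The extended `L₂` norm of a tempered distribution: the `L₂` norm of the (unique) element of
`L₂(ℝ)` that represents it, and `∞` if there is none. -/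
def l2Norm (u : 𝓢'(ℝ, ℂ)) : ℝ≥0∞ :=
  ⨅ (w : Lp ℂ 2 (volume : Measure ℝ)) (_ : (w : 𝓢'(ℝ, ℂ)) = u), ‖w‖ₑ

theorem l2Norm_lt_top_iff (u : 𝓢'(ℝ, ℂ)) :
    l2Norm u < ⊤ ↔ ∃ w : Lp ℂ 2 (volume : Measure ℝ), (w : 𝓢'(ℝ, ℂ)) = u := by
  simp [l2Norm, iInf_lt_iff]

/-- The search space `X₂ = {f real | ‖Lf‖_{L₂} < ∞}`. -/
def X2 (L : 𝓢'(ℝ, ℂ) →L[ℂ] 𝓢'(ℝ, ℂ)) : Submodule ℝ 𝓢'(ℝ, ℂ) where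
  carrier := {f | IsReal f ∧ l2Norm (L f) < ⊤}
  zero_mem' := ⟨fun _ _ => by simp,
    (l2Norm_lt_top_iff _).2 ⟨0, by
      rw [map_zero, ← Lp.toTemperedDistributionCLM_apply, map_zero]⟩⟩
  add_mem' := by
    rintro f g ⟨hf, hf'⟩ ⟨hg, hg'⟩
    obtain ⟨v, hv⟩ := (l2Norm_lt_top_iff _).1 hf'
    obtain ⟨w, hw⟩ := (l2Norm_lt_top_iff _).1 hg'
    refine ⟨fun ψ hψ => by simp [hf ψ hψ, hg ψ hψ], (l2Norm_lt_top_iff _).2 ⟨v + w, ?_⟩⟩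
    rw [map_add, ← hv, ← hw, ← Lp.toTemperedDistributionCLM_apply, map_add]
    rfl
  smul_mem' := by
    rintro c f ⟨hf, hf'⟩
    obtain ⟨v, hv⟩ := (l2Norm_lt_top_iff _).1 hf'
    have hc : c • f = (c : ℂ) • f := by ext ψ; simp
    refine ⟨fun ψ hψ => by simp [hf ψ hψ], (l2Norm_lt_top_iff _).2 ⟨(c : ℂ) • v, ?_⟩⟩
    rw [hc, map_smul, ← hv, ← Lp.toTemperedDistributionCLM_apply, map_smul]
    rfl

/-- The null space `N_L = {p ∈ X₂ | Lp = 0}`. -/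
def nullSpace (L : 𝓢'(ℝ, ℂ) →L[ℂ] 𝓢'(ℝ, ℂ)) : Submodule ℝ (X2 L) where
  carrier := {p | L p = 0}
  zero_mem' := by simp
  add_mem' := by
    intro p q (hp : L p = 0) (hq : L q = 0)
    change L ((p + q : X2 L) : 𝓢'(ℝ, ℂ)) = 0
    rw [Submodule.coe_add, map_add, hp, hq, add_zero]
  smul_mem' := by
    intro c p (hp : L p = 0)
    change L ((c • p : X2 L) : 𝓢'(ℝ, ℂ)) = 0
    have hc : ((c • p : X2 L) : 𝓢'(ℝ, ℂ)) = (c : ℂ) • (p : 𝓢'(ℝ, ℂ)) := by ext ψ; simp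
    rw [hc, map_smul, hp]
    ext ψ
    simp

/-- Spline-admissible operators on tempered distributions. -/
structure SplineAdmissible (L : 𝓢'(ℝ, ℂ) →L[ℂ] 𝓢'(ℝ, ℂ)) : Prop where
  /-- `L` maps real distributions to real distributions. -/
  real : ∀ f, IsReal f → IsReal (L f)
  shift_invariant : ∀ t f, L (shift t f) = shift t (L f)
  finite_nullSpace : FiniteDimensional ℝ (nullSpace L)
  exists_green : ∃ ρ, IsReal ρ ∧ L ρ = TemperedDistribution.delta 0

/-- The adjoint `L*` of a real shift-invariant operator: if `L` is the convolution with `k`, then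
`L*` is the convolution with `k(-·)`. -/
def adjoint (L : 𝓢'(ℝ, ℂ) →L[ℂ] 𝓢'(ℝ, ℂ)) : 𝓢'(ℝ, ℂ) →L[ℂ] 𝓢'(ℝ, ℂ) :=
  reflect ∘L L ∘L reflect

/-- `ρ` is a (real) Green's function of `L*L`. -/
def IsGreenAdjointSelf (L : 𝓢'(ℝ, ℂ) →L[ℂ] 𝓢'(ℝ, ℂ)) (ρ : 𝓢'(ℝ, ℂ)) : Prop :=
  IsReal ρ ∧ adjoint L (L ρ) = TemperedDistribution.delta 0

/-- `Lhat` is the frequency response of `L`: `L{e^{2πiξ·}} = Lhat(ξ) e^{2πiξ·}`. -/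
def IsFrequencyResponse (L : 𝓢'(ℝ, ℂ) →L[ℂ] 𝓢'(ℝ, ℂ)) (Lhat : ℝ → ℂ) : Prop :=
  ∀ ξ, L (cexp ξ) = Lhat ξ • cexp ξ

/-- The identity `g · u = v` between tempered distributions `u`, `v`, where `g` is a function that
maps Schwartz functions to Schwartz functions by multiplication: `⟨u, g ψ⟩ = ⟨v, ψ⟩`. -/
def MulEq (g : ℝ → ℂ) (u v : 𝓢'(ℝ, ℂ)) : Prop :=
  ∀ ψ : 𝓢(ℝ, ℂ), ∃ θ : 𝓢(ℝ, ℂ), (∀ ξ, θ ξ = g ξ * ψ ξ) ∧ u θ = v ψ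

/-- The Hilbert norm `(‖Lf‖² + ∑ₙ ⟨κₙ, f⟩²)^{1/2}` of `X₂`, for a system of Schwartz functions
`κ` biorthonormal to a basis of the null space. -/
def nativeNorm (L : 𝓢'(ℝ, ℂ) →L[ℂ] 𝓢'(ℝ, ℂ)) {N₀ : ℕ} (κ : Fin N₀ → 𝓢(ℝ, ℂ)) (f : X2 L) : ℝ :=
  √((l2Norm (L f)).toReal ^ 2 + ∑ n, (((f : 𝓢'(ℝ, ℂ)) (κ n)).re) ^ 2)

/-- Boundedness of `H : X₂ → ℝ^M`. -/
def IsBoundedMeasurement {L : 𝓢'(ℝ, ℂ) →L[ℂ] 𝓢'(ℝ, ℂ)} {N₀ M : ℕ}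
    (p : Module.Basis (Fin N₀) ℝ (nullSpace L)) (H : X2 L →ₗ[ℝ] (Fin M → ℝ)) : Prop :=
  ∃ κ : Fin N₀ → 𝓢(ℝ, ℂ), (∀ n, IsRealTest (κ n)) ∧
    (∀ i j, ((p i : X2 L) : 𝓢'(ℝ, ℂ)) (κ j) = if i = j then 1 else 0) ∧
    ∃ C : ℝ, ∀ f, ‖H f‖ ≤ C * nativeNorm L κ f

/-- The `m`-th component of `H` is the pairing with the distribution `h m`:
`H{ψ}ₘ = ⟨hₘ, ψ⟩` for (real) Schwartz functions `ψ`. -/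
def IsGivenBy {L : 𝓢'(ℝ, ℂ) →L[ℂ] 𝓢'(ℝ, ℂ)} {M : ℕ}
    (H : X2 L →ₗ[ℝ] (Fin M → ℝ)) (h : Fin M → 𝓢'(ℝ, ℂ)) : Prop :=
  ∀ (m : Fin M) (ψ : 𝓢(ℝ, ℂ)), IsRealTest ψ →
    ∀ hψ : (ψ : 𝓢'(ℝ, ℂ)) ∈ X2 L, h m ψ = (H ⟨ψ, hψ⟩ m : ℂ)

/-- The function `y ↦ ∫ ρ(x - y) ψ(x) dx`, as a tempered distribution; its Fourier transform is the
product of those of `ψ` and of `ρ(-·)`. -/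
def correlate (ρ : 𝓢'(ℝ, ℂ)) (ψ : 𝓢(ℝ, ℂ)) : 𝓢'(ℝ, ℂ) :=
  𝓕⁻ (TemperedDistribution.smulLeftCLM ℂ (𝓕 ψ : 𝓢(ℝ, ℂ)) (𝓕⁻ ρ))

/-- `φ = ℱ⁻¹{ĥ / |Lhat|²} = (L*L)⁻¹ h`, where `h` is a distribution that extends to the
functional `hX` on `X₂`, and `ρ` is the Green's function of `L*L`. Since `Lhat` may vanish, the
quotient is the solution `φ = ρ * h` of `|Lhat|² φ̂ = ĥ`, where the convolution is defined by
duality, `⟨ρ * h, ψ⟩ = ⟨h, ∫ ρ(x - ·) ψ(x) dx⟩`, for the Schwartz functions `ψ` that are orthogonal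
to the null space (for those, the right-hand side is the pairing of `h` with an element of `X₂`).
This determines `φ` up to an element of the null space. -/
structure IsBasisFunction (L : 𝓢'(ℝ, ℂ) →L[ℂ] 𝓢'(ℝ, ℂ)) (Lhat : ℝ → ℂ) (ρ : 𝓢'(ℝ, ℂ))
    (h : 𝓢'(ℝ, ℂ)) (hX : X2 L → ℝ) (φ : 𝓢'(ℝ, ℂ)) : Prop where
  real : IsReal φ
  fourier : MulEq (fun ξ => ((‖Lhat ξ‖ ^ 2 : ℝ) : ℂ)) (𝓕 φ) (𝓕 h)
  inverse : adjoint L (L φ) = h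
  convolution : ∀ ψ : 𝓢(ℝ, ℂ), IsRealTest ψ →
    (∀ q : nullSpace L, ((q : X2 L) : 𝓢'(ℝ, ℂ)) ψ = 0) →
    ∃ hψ : correlate ρ ψ ∈ X2 L, φ ψ = (hX ⟨correlate ρ ψ, hψ⟩ : ℂ)

/-- Convexity of an extended-valued function. -/
def IsConvex {M : ℕ} (F : (Fin M → ℝ) → ℝ≥0∞) : Prop :=
  ∀ u v (s t : ℝ), 0 < s → 0 < t → s + t = 1 →
    F (s • u + t • v) ≤ ENNReal.ofReal s * F u + ENNReal.ofReal t * F v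

/-- Strict convexity of an extended-valued function, on its effective domain. -/
def IsStrictlyConvex {M : ℕ} (F : (Fin M → ℝ) → ℝ≥0∞) : Prop :=
  ∀ u v, u ≠ v → F u ≠ ⊤ → F v ≠ ⊤ → ∀ s t : ℝ, 0 < s → 0 < t → s + t = 1 →
    F (s • u + t • v) < ENNReal.ofReal s * F u + ENNReal.ofReal t * F v

/-- Coercivity: `F u → ∞` as `‖u‖ → ∞`. -/
def IsCoercive {M : ℕ} (F : (Fin M → ℝ) → ℝ≥0∞) : Prop :=
  Tendsto F (cocompact (Fin M → ℝ)) (𝓝 ⊤)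

/-- The cost `E(z, H{f}) + lam ‖Lf‖²`. -/
def cost {M : ℕ} (L : 𝓢'(ℝ, ℂ) →L[ℂ] 𝓢'(ℝ, ℂ)) (H : X2 L →ₗ[ℝ] (Fin M → ℝ))
    (E : (Fin M → ℝ) → (Fin M → ℝ) → ℝ≥0∞) (z : Fin M → ℝ) (lam : ℝ) (f : X2 L) : ℝ≥0∞ :=
  E z (H f) + ENNReal.ofReal lam * l2Norm (L f) ^ 2

/-- `f` minimizes `J` over `X₂`. -/
def IsMinimizer {L : 𝓢'(ℝ, ℂ) →L[ℂ] 𝓢'(ℝ, ℂ)} (J : X2 L → ℝ≥0∞) (f : X2 L) : Prop :=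
  ∀ g, J f ≤ J g

end Tikhonov

end

open Tikhonov

noncomputable section

namespace Tikhonov

open MeasureTheory Filter Topology

/-! ### Conjugation and reflection of Schwartz functions -/

/-! The search space is a Hilbert space in disguise. Since `L` is continuous for pointwise
convergence, it has a transpose `T` on Schwartz functions, and the frequency response makes `T` a
Fourier multiplier. The Green's function then gives L(ρ^∨ * Tη) = η. By Hahn–Banach, every ψ
orthogonal to the null space is a limit of functions Tη; passing to the limit
(`exists_l2_correlate`) shows that L(ρ^∨ * ψ) is square-integrable and that ⟨f, ψ⟩ = ⟨Lf, L(ρ^∨ *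
ψ)⟩ for f in `X2 L`. The same construction makes `L` surjective onto the real L₂ functions, so `X2
L` is isomorphic to `realL2` × ℝ^N₀ (`bijective_l2Image_prod_pairings`), where the measurements are
continuous.

Existence then reduces to finite dimension by an orthogonal projection, and uniqueness follows from
the parallelogram law together with strict convexity. At a minimizer f, ⟨Lf, Lg⟩ vanishes whenever
Hg = 0, so ⟨Lf, Lg⟩ = ∑ aₘ H(g)ₘ for all g. The choice g = ρ^∨ * ψ turns this into ⟨f, ψ⟩ = ∑ aₘ⟨φₘ,
ψ⟩, hence f - ∑ aₘφₘ lies in the null space; the choice g = pₙ gives the orthogonality conditions.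
-/

/-- Pointwise complex conjugation of Schwartz functions. -/
def conjS : 𝓢(ℝ, ℂ) →L[ℝ] 𝓢(ℝ, ℂ) :=
  SchwartzMap.postcompCLM (𝕜 := ℝ) (Complex.conjCLE : ℂ →L[ℝ] ℂ)

@[simp]
theorem conjS_apply (ψ : 𝓢(ℝ, ℂ)) (x : ℝ) : conjS ψ x = (starRingEnd ℂ) (ψ x) := rfl

@[simp]
theorem conjS_conjS (ψ : 𝓢(ℝ, ℂ)) : conjS (conjS ψ) = ψ := by
  ext x; simp

theorem conjS_smul (c : ℂ) (ψ : 𝓢(ℝ, ℂ)) : conjS (c • ψ) = (starRingEnd ℂ) c • conjS ψ := by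
  ext x; simp

theorem isRealTest_iff (ψ : 𝓢(ℝ, ℂ)) : IsRealTest ψ ↔ conjS ψ = ψ := by
  simp only [IsRealTest, SchwartzMap.ext_iff, conjS_apply, Complex.conj_eq_iff_im]

theorem isRealTest_add_conjS (ψ : 𝓢(ℝ, ℂ)) : IsRealTest ((1 / 2 : ℂ) • (ψ + conjS ψ)) := by
  intro x
  simp

theorem isRealTest_sub_conjS (ψ : 𝓢(ℝ, ℂ)) :
    IsRealTest ((-(Complex.I / 2)) • (ψ - conjS ψ)) := by
  intro x
  simp

theorem eq_re_add_im (ψ : 𝓢(ℝ, ℂ)) :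
    ψ = (1 / 2 : ℂ) • (ψ + conjS ψ) + Complex.I • ((-(Complex.I / 2)) • (ψ - conjS ψ)) := by
  ext x
  simp only [add_apply, smul_apply, sub_apply, smul_eq_mul]
  linear_combination (1 / 2 * (ψ x - conjS ψ x)) * Complex.I_sq

/-- Reflection of Schwartz functions. -/
def reflS : 𝓢(ℝ, ℂ) →L[ℂ] 𝓢(ℝ, ℂ) :=
  SchwartzMap.compCLMOfContinuousLinearEquiv ℂ (ContinuousLinearEquiv.neg ℝ)

@[simp]
theorem reflS_apply (ψ : 𝓢(ℝ, ℂ)) (x : ℝ) : reflS ψ x = ψ (-x) := rfl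

theorem fourierInv_apply_eq_fourier_neg (ψ : 𝓢(ℝ, ℂ)) (ξ : ℝ) : 𝓕⁻ ψ ξ = 𝓕 ψ (-ξ) := rfl

theorem fourier_apply_eq_fourierInv_neg (ψ : 𝓢(ℝ, ℂ)) (ξ : ℝ) : 𝓕 ψ ξ = 𝓕⁻ ψ (-ξ) := by
  rw [fourierInv_apply_eq_fourier_neg, neg_neg]

theorem fourier_conjS (ψ : 𝓢(ℝ, ℂ)) (ξ : ℝ) :
    𝓕 (conjS ψ) ξ = (starRingEnd ℂ) (𝓕⁻ ψ ξ) := by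
  rw [SchwartzMap.fourier_coe, SchwartzMap.fourierInv_coe, Real.fourier_eq, Real.fourierInv_eq,
    ← integral_conj]
  refine integral_congr_ae (Eventually.of_forall fun x => ?_)
  simp [Circle.smul_def, Real.fourierChar_apply, ← Complex.exp_conj, Complex.conj_ofNat]

theorem fourierInv_conjS (ψ : 𝓢(ℝ, ℂ)) (ξ : ℝ) :
    𝓕⁻ (conjS ψ) ξ = (starRingEnd ℂ) (𝓕 ψ ξ) := by
  rw [fourierInv_apply_eq_fourier_neg, fourier_conjS, ← fourier_apply_eq_fourierInv_neg]

theorem fourierInv_reflS (ψ : 𝓢(ℝ, ℂ)) (ξ : ℝ) : 𝓕⁻ (reflS ψ) ξ = 𝓕⁻ ψ (-ξ) := by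
  rw [SchwartzMap.fourierInv_coe, SchwartzMap.fourierInv_coe, Real.fourierInv_eq,
    Real.fourierInv_eq, ← integral_neg_eq_self]
  simp

theorem schwartz_ext_fourierInv {ψ χ : 𝓢(ℝ, ℂ)} (h : ∀ ξ, 𝓕⁻ ψ ξ = 𝓕⁻ χ ξ) : ψ = χ := by
  have h1 : 𝓕 (𝓕⁻ ψ) = 𝓕 (𝓕⁻ χ) := congrArg _ (SchwartzMap.ext h)
  rwa [FourierTransform.fourier_fourierInv_eq, FourierTransform.fourier_fourierInv_eq] at h1

/-! ### Products of Schwartz functions -/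

/-- The product of two Schwartz functions. -/
def mulS (ψ χ : 𝓢(ℝ, ℂ)) : 𝓢(ℝ, ℂ) := SchwartzMap.smulLeftCLM ℂ ψ χ

@[simp]
theorem mulS_apply (ψ χ : 𝓢(ℝ, ℂ)) (x : ℝ) : mulS ψ χ x = ψ x * χ x := by
  simp [mulS, ψ.hasTemperateGrowth]

theorem seminorm_mulS_le (k n : ℕ) (ψ χ : 𝓢(ℝ, ℂ)) :
    SchwartzMap.seminorm ℂ k n (mulS ψ χ) ≤ ∑ i ∈ Finset.range (n + 1), (n.choose i : ℝ) *
      SchwartzMap.seminorm ℂ k i ψ * SchwartzMap.seminorm ℂ 0 (n - i) χ := by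
  refine SchwartzMap.seminorm_le_bound ℂ k n _ (by positivity) fun x => ?_
  have hcoe : (mulS ψ χ : ℝ → ℂ) = fun x => ψ x * χ x := funext (mulS_apply ψ χ)
  rw [hcoe]
  refine (mul_le_mul_of_nonneg_left (norm_iteratedFDeriv_mul_le (ψ.smooth n) (χ.smooth n) x
    le_rfl) (by positivity)).trans ?_
  rw [Finset.mul_sum]
  refine Finset.sum_le_sum fun i _ => ?_
  calc _ = (n.choose i : ℝ) * (‖x‖ ^ k * ‖iteratedFDeriv ℝ i ψ x‖) *
        ‖iteratedFDeriv ℝ (n - i) χ x‖ := by ring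
    _ ≤ _ := by
      gcongr
      · exact SchwartzMap.le_seminorm ℂ k i ψ x
      · exact SchwartzMap.norm_iteratedFDeriv_le_seminorm ℂ χ (n - i) x

/-- Joint convergence is needed because both arguments of the correlation form vary in the Cauchy
estimates below. It comes from the Leibniz bound, with the whole polynomial weight put on the first
factor. -/
theorem tendsto_mulS_zero {ι : Type*} {l : Filter ι} {a b : ι → 𝓢(ℝ, ℂ)}
    (ha : Tendsto a l (𝓝 0)) (hb : Tendsto b l (𝓝 0)) :
    Tendsto (fun i => mulS (a i) (b i)) l (𝓝 0) := by
  have hs (k n : ℕ) {c : ι → 𝓢(ℝ, ℂ)} (hc : Tendsto c l (𝓝 0)) :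
      Tendsto (fun i => SchwartzMap.seminorm ℂ k n (c i)) l (𝓝 0) := by
    have h1 : Continuous (SchwartzMap.seminorm ℂ k n : Seminorm ℂ 𝓢(ℝ, ℂ)) :=
      (schwartz_withSeminorms ℂ ℝ ℂ).continuous_seminorm (k, n)
    simpa using! (h1.tendsto 0).comp hc
  refine ((schwartz_withSeminorms ℂ ℝ ℂ).tendsto_nhds _ _).2 ?_
  rintro ⟨k, n⟩ ε hε
  have h2 : Tendsto (fun i => ∑ j ∈ Finset.range (n + 1), (n.choose j : ℝ) *
      SchwartzMap.seminorm ℂ k j (a i) * SchwartzMap.seminorm ℂ 0 (n - j) (b i)) l (𝓝 0) := by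
    rw [show (0 : ℝ) = ∑ j ∈ Finset.range (n + 1), (n.choose j : ℝ) * 0 * 0 by simp]
    exact tendsto_finsetSum _ fun j _ => ((hs k j ha).const_mul _).mul (hs 0 (n - j) hb)
  filter_upwards [h2.eventually (gt_mem_nhds hε)] with i hi
  rw [sub_zero]
  exact (seminorm_mulS_le k n (a i) (b i)).trans_lt hi

/-! ### The correlation form -/

theorem correlate_apply (ρ : 𝓢'(ℝ, ℂ)) (ψ χ : 𝓢(ℝ, ℂ)) :
    correlate ρ ψ χ = ρ (𝓕⁻ (mulS (𝓕 ψ) (𝓕⁻ χ))) := rfl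

theorem mulS_add_left (ψ ψ' χ : 𝓢(ℝ, ℂ)) : mulS (ψ + ψ') χ = mulS ψ χ + mulS ψ' χ := by
  ext x; simp [add_mul]

theorem mulS_smul_left (c : ℂ) (ψ χ : 𝓢(ℝ, ℂ)) : mulS (c • ψ) χ = c • mulS ψ χ := by
  ext x; simp [mul_assoc]

/-- The correlation of `ρ` with a Schwartz function, as a linear map. -/
def correlateₗ (ρ : 𝓢'(ℝ, ℂ)) : 𝓢(ℝ, ℂ) →ₗ[ℂ] 𝓢'(ℝ, ℂ) where
  toFun := correlate ρ
  map_add' ψ ψ' := by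
    ext χ
    change correlate ρ (ψ + ψ') χ = correlate ρ ψ χ + correlate ρ ψ' χ
    simp only [correlate_apply, FourierTransform.fourier_add, mulS_add_left,
      FourierTransform.fourierInv_add, map_add]
  map_smul' c ψ := by
    ext χ
    change correlate ρ (c • ψ) χ = c • correlate ρ ψ χ
    simp only [correlate_apply, FourierTransform.fourier_smul, mulS_smul_left,
      FourierTransform.fourierInv_smul, map_smul]

/-- On the Fourier side both pairings apply ρ to the same product, up to ξ ↦ -ξ. This gives
continuity in ψ, and later turns a pairing with `κ n` into a distribution acting on ψ. -/
theorem correlate_reflect_apply (ρ : 𝓢'(ℝ, ℂ)) (ψ χ : 𝓢(ℝ, ℂ)) :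
    correlate (reflect ρ) χ ψ = correlate ρ ψ χ := by
  rw [correlate_apply, correlate_apply, reflect_apply]
  congr 1
  refine schwartz_ext_fourierInv fun ξ => ?_
  change 𝓕⁻ (reflS _) ξ = _
  rw [fourierInv_reflS, fourierInv_apply_eq_fourier_neg, fourierInv_apply_eq_fourier_neg,
    FourierTransform.fourier_fourierInv_eq, FourierTransform.fourier_fourierInv_eq, mulS_apply,
    mulS_apply, fourierInv_apply_eq_fourier_neg, fourierInv_apply_eq_fourier_neg, neg_neg, mul_comm]

theorem continuous_correlate_left (ρ : 𝓢'(ℝ, ℂ)) (χ : 𝓢(ℝ, ℂ)) :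
    Continuous fun ψ => correlate ρ ψ χ := by
  refine (map_continuous (correlate (reflect ρ) χ)).congr fun ψ => ?_
  exact correlate_reflect_apply ρ ψ χ

theorem continuous_correlate (ρ : 𝓢'(ℝ, ℂ)) : Continuous (correlate ρ) :=
  PointwiseConvergenceCLM.continuous_of_continuous_eval (continuous_correlate_left ρ)

theorem tendsto_correlate_zero (ρ : 𝓢'(ℝ, ℂ)) {ι : Type*} {l : Filter ι} {a b : ι → 𝓢(ℝ, ℂ)}
    (ha : Tendsto a l (𝓝 0)) (hb : Tendsto b l (𝓝 0)) :
    Tendsto (fun i => correlate ρ (a i) (b i)) l (𝓝 0) := by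
  have h1 : Tendsto (fun i => 𝓕 (a i)) l (𝓝 0) := by
    simpa using! ((FourierTransform.fourierCLM ℂ 𝓢(ℝ, ℂ)).continuous.tendsto 0).comp ha
  have h2 : Tendsto (fun i => 𝓕⁻ (b i)) l (𝓝 0) := by
    simpa using! ((FourierTransform.fourierInvCLM ℂ 𝓢(ℝ, ℂ)).continuous.tendsto 0).comp hb
  have h3 := ((FourierTransform.fourierInvCLM ℂ 𝓢(ℝ, ℂ)).continuous.tendsto 0).comp
    (tendsto_mulS_zero h1 h2)
  simpa using! ((map_continuous ρ).tendsto _).comp h3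

theorem tendsto_correlate (ρ : 𝓢'(ℝ, ℂ)) {ι : Type*} {l : Filter ι} {a b : ι → 𝓢(ℝ, ℂ)}
    {a₀ b₀ : 𝓢(ℝ, ℂ)} (ha : Tendsto a l (𝓝 a₀)) (hb : Tendsto b l (𝓝 b₀)) :
    Tendsto (fun i => correlate ρ (a i) (b i)) l (𝓝 (correlate ρ a₀ b₀)) := by
  -- Bilinear splitting B(a, b) = B(a - a₀, b - b₀) + B(a, b₀) + B(a₀, b) - B(a₀, b₀).
  have h1 := tendsto_correlate_zero ρ (a := fun i => a i - a₀) (b := fun i => b i - b₀)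
    (by simpa using ha.sub_const a₀) (by simpa using hb.sub_const b₀)
  have h2 := ((continuous_correlate_left ρ b₀).tendsto a₀).comp ha
  have h3 := ((map_continuous (correlate ρ a₀)).tendsto b₀).comp hb
  have h4 := (h1.add (h2.add h3)).sub_const (correlate ρ a₀ b₀)
  simp only [zero_add, add_sub_cancel_right] at h4
  refine h4.congr fun i => ?_
  have h5 : correlate ρ (a i - a₀) = correlate ρ (a i) - correlate ρ a₀ :=
    map_sub (correlateₗ ρ) _ _
  rw [h5]
  change (correlate ρ (a i) (b i - b₀) - correlate ρ a₀ (b i - b₀)) + (_ + _) - _ = _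
  simp only [map_sub, Function.comp_apply]
  ring

theorem isReal_correlate {ρ : 𝓢'(ℝ, ℂ)} (hρ : IsReal ρ) {ψ : 𝓢(ℝ, ℂ)} (hψ : IsRealTest ψ) :
    IsReal (correlate ρ ψ) := by
  intro χ hχ
  rw [correlate_apply]
  apply hρ
  rw [isRealTest_iff] at *
  refine schwartz_ext_fourierInv fun ξ => ?_
  rw [fourierInv_conjS, FourierTransform.fourier_fourierInv_eq, fourierInv_apply_eq_fourier_neg,
    FourierTransform.fourier_fourierInv_eq, mulS_apply, mulS_apply, map_mul, ← fourierInv_conjS,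
    ← fourier_conjS, hψ, hχ, fourierInv_apply_eq_fourier_neg ψ, fourierInv_apply_eq_fourier_neg,
    neg_neg]

/-! ### Complex conjugation of tempered distributions -/

/-- The complex conjugate of a tempered distribution. -/
def conjD (f : 𝓢'(ℝ, ℂ)) : 𝓢'(ℝ, ℂ) :=
  ContinuousLinearMap.toPointwiseConvergenceCLM ℂ (RingHom.id ℂ) 𝓢(ℝ, ℂ) ℂ
    { toFun := fun ψ => (starRingEnd ℂ) (f (conjS ψ))
      map_add' := fun ψ χ => by simp
      map_smul' := fun c ψ => by simp [conjS_smul]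
      cont := Complex.continuous_conj.comp ((map_continuous f).comp conjS.continuous) }

@[simp]
theorem conjD_apply (f : 𝓢'(ℝ, ℂ)) (ψ : 𝓢(ℝ, ℂ)) :
    conjD f ψ = (starRingEnd ℂ) (f (conjS ψ)) := rfl

theorem IsReal.apply_conjS {f : 𝓢'(ℝ, ℂ)} (hf : IsReal f) (ψ : 𝓢(ℝ, ℂ)) :
    f (conjS ψ) = (starRingEnd ℂ) (f ψ) := by
  have h1 := Complex.conj_eq_iff_im.2 (hf _ (isRealTest_add_conjS ψ))
  have h2 := Complex.conj_eq_iff_im.2 (hf _ (isRealTest_sub_conjS ψ))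
  simp only [map_smul, map_add, map_sub, smul_eq_mul, map_mul, map_neg, map_div₀, Complex.conj_I,
    map_one, Complex.conj_ofNat] at h1 h2
  have h3 : Complex.I * ((starRingEnd ℂ) (f ψ) - (starRingEnd ℂ) (f (conjS ψ))) =
      Complex.I * (f (conjS ψ) - f ψ) := by linear_combination 2 * h2
  have h4 := mul_left_cancel₀ Complex.I_ne_zero h3
  linear_combination (-1) * h1 + (-1 / 2) * h4

theorem isReal_iff_conjD (f : 𝓢'(ℝ, ℂ)) : IsReal f ↔ conjD f = f := by
  refine ⟨fun hf => ?_, fun hf ψ hψ => ?_⟩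
  · ext ψ
    rw [conjD_apply, hf.apply_conjS, Complex.conj_conj]
  · rw [isRealTest_iff] at hψ
    rw [← Complex.conj_eq_iff_im]
    conv_rhs => rw [← hf, conjD_apply, hψ]

theorem isReal_add_conjD (f : 𝓢'(ℝ, ℂ)) : IsReal ((1 / 2 : ℂ) • (f + conjD f)) := by
  intro ψ hψ
  rw [isRealTest_iff] at hψ
  change ((1 / 2 : ℂ) • (f ψ + (starRingEnd ℂ) (f (conjS ψ)))).im = 0
  rw [hψ]
  simp

theorem isReal_sub_conjD (f : 𝓢'(ℝ, ℂ)) : IsReal ((-(Complex.I / 2)) • (f - conjD f)) := by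
  intro ψ hψ
  rw [isRealTest_iff] at hψ
  change ((-(Complex.I / 2)) • (f ψ - (starRingEnd ℂ) (f (conjS ψ)))).im = 0
  rw [hψ]
  simp

/-! ### The transpose of an operator on tempered distributions -/

/-- `T` is the transpose of `L`: `⟨L f, ψ⟩ = ⟨f, T ψ⟩`. -/
def IsTranspose (L : 𝓢'(ℝ, ℂ) →L[ℂ] 𝓢'(ℝ, ℂ)) (T : 𝓢(ℝ, ℂ) →ₗ[ℂ] 𝓢(ℝ, ℂ)) : Prop :=
  ∀ f ψ, L f ψ = f (T ψ)

theorem schwartz_ext_distribution {ψ χ : 𝓢(ℝ, ℂ)} (h : ∀ f : 𝓢'(ℝ, ℂ), f ψ = f χ) : ψ = χ :=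
  SchwartzMap.ext fun x => h (TemperedDistribution.delta x)

/-- Every continuous functional on tempered distributions is the evaluation at a Schwartz
function. -/
theorem exists_eq_apply (u : 𝓢'(ℝ, ℂ) →L[ℂ] ℂ) : ∃ ψ : 𝓢(ℝ, ℂ), ∀ f, u f = f ψ := by
  -- With pointwise convergence, 𝓢' is a weak dual, and the continuous dual of a weak dual is the
  -- original space.
  obtain ⟨ψ, hψ⟩ := LinearMap.dualEmbedding_surjective (topDualPairing ℂ 𝓢(ℝ, ℂ))
    (u ∘L ((PointwiseConvergenceCLM.equivWeakDual ℂ 𝓢(ℝ, ℂ)).symm :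
      WeakDual ℂ 𝓢(ℝ, ℂ) →L[ℂ] 𝓢'(ℝ, ℂ)))
  exact ⟨ψ, fun f => (DFunLike.congr_fun hψ
    (PointwiseConvergenceCLM.equivWeakDual ℂ 𝓢(ℝ, ℂ) f)).symm⟩

/-- Linearity comes from uniqueness, as distributions separate Schwartz functions. -/
theorem exists_isTranspose (L : 𝓢'(ℝ, ℂ) →L[ℂ] 𝓢'(ℝ, ℂ)) : ∃ T, IsTranspose L T := by
  have h1 (ψ : 𝓢(ℝ, ℂ)) : ∃ χ : 𝓢(ℝ, ℂ), ∀ f, L f ψ = f χ :=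
    exists_eq_apply (PointwiseConvergenceCLM.evalCLM (RingHom.id ℂ) ℂ ψ ∘L L)
  choose T hT using h1
  refine ⟨{ toFun := T, map_add' := fun ψ χ => ?_, map_smul' := fun c ψ => ?_ }, fun f ψ => hT ψ f⟩
  · refine schwartz_ext_distribution fun f => ?_
    rw [map_add, ← hT, ← hT, ← hT, map_add]
  · refine schwartz_ext_distribution fun f => ?_
    rw [RingHom.id_apply, map_smul, ← hT, ← hT, map_smul]

section Transpose

variable {L : 𝓢'(ℝ, ℂ) →L[ℂ] 𝓢'(ℝ, ℂ)} {T : 𝓢(ℝ, ℂ) →ₗ[ℂ] 𝓢(ℝ, ℂ)} {Lhat : ℝ → ℂ}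
  {ρ : 𝓢'(ℝ, ℂ)}

theorem IsTranspose.conjS_comm (hT : IsTranspose L T) (hL : ∀ f, IsReal f → IsReal (L f))
    (ψ : 𝓢(ℝ, ℂ)) : T (conjS ψ) = conjS (T ψ) := by
  ext x
  have hδ : IsReal (TemperedDistribution.delta x : 𝓢'(ℝ, ℂ)) := fun ψ hψ => hψ x
  have h1 := (hL _ hδ).apply_conjS ψ
  rwa [hT, hT] at h1

theorem IsTranspose.conjD_comm (hT : IsTranspose L T) (hL : ∀ f, IsReal f → IsReal (L f))
    (f : 𝓢'(ℝ, ℂ)) : L (conjD f) = conjD (L f) := by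
  ext ψ
  rw [hT, conjD_apply, conjD_apply, hT, hT.conjS_comm hL]

/-- The value 𝓕⁻ψ(ξ) is the pairing of ψ with the exponential of frequency ξ, an eigenvector of `L`.
-/
theorem IsTranspose.fourierInv_apply (hT : IsTranspose L T) (hLhat : IsFrequencyResponse L Lhat)
    (ψ : 𝓢(ℝ, ℂ)) (ξ : ℝ) : 𝓕⁻ (T ψ) ξ = Lhat ξ * 𝓕⁻ ψ ξ := by
  have h1 : L (cexp ξ) ψ = (Lhat ξ • cexp ξ) ψ := by rw [hLhat ξ]
  rwa [hT] at h1

theorem IsTranspose.fourier_apply (hT : IsTranspose L T) (hLhat : IsFrequencyResponse L Lhat)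
    (ψ : 𝓢(ℝ, ℂ)) (ξ : ℝ) : 𝓕 (T ψ) ξ = Lhat (-ξ) * 𝓕 ψ ξ := by
  rw [fourier_apply_eq_fourierInv_neg, hT.fourierInv_apply hLhat, ← fourier_apply_eq_fourierInv_neg]

theorem IsTranspose.adjoint_apply (hT : IsTranspose L T) (f : 𝓢'(ℝ, ℂ)) (ψ : 𝓢(ℝ, ℂ)) :
    adjoint L (L f) ψ = f (T (reflS (T (reflS ψ)))) := by
  change L (reflect (L f)) (reflS ψ) = _
  rw [hT]
  change L f (reflS (T (reflS ψ))) = _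
  rw [hT]

theorem IsTranspose.fourierInv_normal (hT : IsTranspose L T) (hLhat : IsFrequencyResponse L Lhat)
    (ψ : 𝓢(ℝ, ℂ)) (ξ : ℝ) :
    𝓕⁻ (T (reflS (T (reflS ψ)))) ξ = Lhat ξ * Lhat (-ξ) * 𝓕⁻ ψ ξ := by
  rw [hT.fourierInv_apply hLhat, fourierInv_reflS, hT.fourierInv_apply hLhat, fourierInv_reflS,
    neg_neg, mul_assoc]

theorem IsTranspose.fourier_normal (hT : IsTranspose L T) (hLhat : IsFrequencyResponse L Lhat)
    (ψ : 𝓢(ℝ, ℂ)) (ξ : ℝ) :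
    𝓕 (T (reflS (T (reflS ψ)))) ξ = Lhat ξ * Lhat (-ξ) * 𝓕 ψ ξ := by
  rw [fourier_apply_eq_fourierInv_neg, hT.fourierInv_normal hLhat, neg_neg,
    ← fourier_apply_eq_fourierInv_neg]
  ring

/-! ### Identities for the Green's function of L*L -/

theorem fourierInv_mulS_zero (ψ χ : 𝓢(ℝ, ℂ)) :
    𝓕⁻ (mulS (𝓕 ψ) (𝓕⁻ χ)) 0 = ∫ x, χ x * ψ x := by
  rw [SchwartzMap.fourierInv_coe, Real.fourierInv_eq]
  simp only [inner_zero_right, AddChar.map_zero_eq_one, one_smul, mulS_apply]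
  rw [SchwartzMap.integral_fourier_mul_eq, FourierTransform.fourier_fourierInv_eq]
  simp_rw [mul_comm]

/-- The correlation form of the Green's function, tested against a product with `|Lhat|²`. -/
theorem green_apply (hT : IsTranspose L T) (hLhat : IsFrequencyResponse L Lhat)
    (hρ : IsGreenAdjointSelf L ρ) {ψ χ Θ : 𝓢(ℝ, ℂ)}
    (hΘ : ∀ ξ, Θ ξ = Lhat ξ * Lhat (-ξ) * (𝓕 ψ ξ * 𝓕⁻ χ ξ)) :
    ρ (𝓕⁻ Θ) = ∫ x, χ x * ψ x := by
  -- The multiplier Lhat(ξ)Lhat(-ξ) is that of the transpose of L*L; moved onto ρ it yields δ, which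
  -- evaluates the remaining factor at 0.
  have h1 : 𝓕⁻ Θ = T (reflS (T (reflS (𝓕⁻ (mulS (𝓕 ψ) (𝓕⁻ χ)))))) := by
    refine schwartz_ext_fourierInv fun ξ => ?_
    rw [hT.fourierInv_normal hLhat, fourierInv_apply_eq_fourier_neg,
      fourierInv_apply_eq_fourier_neg, FourierTransform.fourier_fourierInv_eq,
      FourierTransform.fourier_fourierInv_eq, hΘ, mulS_apply, neg_neg]
    ring
  rw [h1, ← hT.adjoint_apply, hρ.2, TemperedDistribution.delta_apply, fourierInv_mulS_zero]

/-- One factor of the multiplier comes from `T η`, the other from transposing the outer `L`. -/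
theorem apply_correlate_transpose (hT : IsTranspose L T) (hLhat : IsFrequencyResponse L Lhat)
    (hρ : IsGreenAdjointSelf L ρ) (η : 𝓢(ℝ, ℂ)) :
    L (correlate ρ (T η)) = (η : 𝓢'(ℝ, ℂ)) := by
  ext ψ
  rw [hT, correlate_apply, SchwartzMap.coe_apply]
  refine green_apply hT hLhat hρ fun ξ => ?_
  rw [mulS_apply, hT.fourier_apply hLhat, hT.fourierInv_apply hLhat]
  ring

theorem correlate_normal (hT : IsTranspose L T) (hLhat : IsFrequencyResponse L Lhat)
    (hρ : IsGreenAdjointSelf L ρ) (ψ : 𝓢(ℝ, ℂ)) :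
    correlate ρ (T (reflS (T (reflS ψ)))) = (ψ : 𝓢'(ℝ, ℂ)) := by
  ext χ
  rw [correlate_apply, SchwartzMap.coe_apply]
  refine green_apply hT hLhat hρ fun ξ => ?_
  rw [mulS_apply, hT.fourier_normal hLhat]
  ring

theorem IsTranspose.frequencyResponse_mul (hT : IsTranspose L T)
    (hLhat : IsFrequencyResponse L Lhat) (hL : ∀ f, IsReal f → IsReal (L f))
    (ψ : 𝓢(ℝ, ℂ)) (ξ : ℝ) :
    Lhat ξ * Lhat (-ξ) * ψ ξ = ((‖Lhat ξ‖ ^ 2 : ℝ) : ℂ) * ψ ξ := by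
  rcases eq_or_ne (ψ ξ) 0 with h0 | h0
  · rw [h0, mul_zero, mul_zero]
  -- Commutation of `T` with conjugation, tested on 𝓕ψ, forces Lhat(-ξ) to be the conjugate of
  -- Lhat(ξ) wherever ψ(ξ) ≠ 0.
  have h1 : 𝓕 (T (conjS (𝓕 ψ))) ξ = 𝓕 (conjS (T (𝓕 ψ))) ξ := by rw [hT.conjS_comm hL]
  rw [hT.fourier_apply hLhat, fourier_conjS, fourier_conjS, hT.fourierInv_apply hLhat,
    FourierTransform.fourierInv_fourier_eq, map_mul] at h1
  have h2 : Lhat (-ξ) = (starRingEnd ℂ) (Lhat ξ) :=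
    mul_right_cancel₀ ((map_ne_zero (starRingEnd ℂ)).2 h0) h1
  rw [h2, Complex.mul_conj, Complex.normSq_eq_norm_sq]

/-! ### Schwartz functions orthogonal to the null space -/

/-- The Schwartz functions orthogonal to the null space of `L`. -/
def orthNull (L : 𝓢'(ℝ, ℂ) →L[ℂ] 𝓢'(ℝ, ℂ)) : Submodule ℂ 𝓢(ℝ, ℂ) where
  carrier := {ψ | ∀ q : nullSpace L, ((q : X2 L) : 𝓢'(ℝ, ℂ)) ψ = 0}
  zero_mem' := fun q => map_zero _
  add_mem' := fun ha hb q => by rw [map_add, ha q, hb q, add_zero]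
  smul_mem' := fun c a ha q => by rw [map_smul, ha q, smul_zero]

theorem l2Norm_zero_lt_top : l2Norm 0 < ⊤ :=
  (l2Norm_lt_top_iff _).2 ⟨0, by rw [← Lp.toTemperedDistributionCLM_apply, map_zero]⟩

theorem IsTranspose.mem_orthNull (hT : IsTranspose L T) (η : 𝓢(ℝ, ℂ)) : T η ∈ orthNull L := by
  intro q
  rw [← hT, show L ((q : X2 L) : 𝓢'(ℝ, ℂ)) = 0 from q.2]
  rfl

theorem apply_eq_zero_of_mem_orthNull {ψ : 𝓢(ℝ, ℂ)} (hψ : ψ ∈ orthNull L) {f : 𝓢'(ℝ, ℂ)}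
    (hf : IsReal f) (hLf : L f = 0) : f ψ = 0 :=
  hψ ⟨⟨f, hf, by rw [hLf]; exact l2Norm_zero_lt_top⟩, hLf⟩

/-- A functional separating ψ from the range of `T` is a tempered distribution killed by `L`. Its
real and imaginary parts then lie in the null space, so it vanishes at ψ, a contradiction. -/
theorem mem_closure_range_transpose (hT : IsTranspose L T) (hL : ∀ f, IsReal f → IsReal (L f))
    {ψ : 𝓢(ℝ, ℂ)} (hψ : ψ ∈ orthNull L) : ψ ∈ closure (Set.range T) := by
  by_contra hcl
  have hset : Set.range T = ((LinearMap.range T).restrictScalars ℝ : Set 𝓢(ℝ, ℂ)) := by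
    ext; simp
  have hconv : Convex ℝ (closure (Set.range T)) := by
    rw [hset]; exact (Submodule.convex _).closure
  obtain ⟨u, s, hus, hsψ⟩ := RCLike.geometric_hahn_banach_closed_point (𝕜 := ℂ) hconv
    isClosed_closure hcl
  have hs0 : 0 < s := by simpa using hus 0 (subset_closure ⟨0, map_zero T⟩)
  have huT (η : 𝓢(ℝ, ℂ)) : u (T η) = 0 := by
    by_contra hne
    -- The rescaling makes the functional take exactly the value s, which the strict bound excludes.
    have h1 := hus (T (((s : ℂ) / u (T η)) • η)) (subset_closure ⟨_, rfl⟩)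
    rw [map_smul, map_smul, smul_eq_mul, div_mul_cancel₀ _ hne] at h1
    simp at h1
  let f : 𝓢'(ℝ, ℂ) := ContinuousLinearMap.toPointwiseConvergenceCLM ℂ (RingHom.id ℂ) 𝓢(ℝ, ℂ) ℂ u
  have hLf : L f = 0 := by
    ext η
    rw [hT]
    exact huT η
  have hLf' : L (conjD f) = 0 := by
    rw [hT.conjD_comm hL, hLf]
    ext η
    simp
  have h1 := apply_eq_zero_of_mem_orthNull hψ (isReal_add_conjD f)
    (by rw [map_smul, map_add, hLf, hLf', add_zero]; ext; simp)
  have h2 := apply_eq_zero_of_mem_orthNull hψ (isReal_sub_conjD f)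
    (by rw [map_smul, map_sub, hLf, hLf', sub_zero]; ext; simp)
  change (1 / 2 : ℂ) * (f ψ + conjD f ψ) = 0 at h1
  change (-(Complex.I / 2)) * (f ψ - conjD f ψ) = 0 at h2
  have h3 : f ψ = 0 := by
    linear_combination h1 + Complex.I * h2 + (1 / 2 * (f ψ - conjD f ψ)) * Complex.I_sq
  have h4 : u ψ = 0 := h3
  rw [h4, map_zero] at hsψ
  exact lt_asymm hs0 hsψ

end Transpose

/-! ### Tempered distributions represented by square-integrable functions -/

theorem l2_ext {v w : Lp ℂ 2 (volume : Measure ℝ)} (h : (v : 𝓢'(ℝ, ℂ)) = (w : 𝓢'(ℝ, ℂ))) :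
    v = w :=
  LinearMap.ker_eq_bot.1 (Lp.ker_toTemperedDistributionCLM_eq_bot (F := ℂ) (μ := volume) (p := 2)) h

theorem coe_l2_add (v w : Lp ℂ 2 (volume : Measure ℝ)) :
    ((v + w : Lp ℂ 2 (volume : Measure ℝ)) : 𝓢'(ℝ, ℂ)) = (v : 𝓢'(ℝ, ℂ)) + (w : 𝓢'(ℝ, ℂ)) :=
  map_add (Lp.toTemperedDistributionCLM ℂ volume 2) v w

theorem coe_l2_smul (c : ℂ) (v : Lp ℂ 2 (volume : Measure ℝ)) :
    ((c • v : Lp ℂ 2 (volume : Measure ℝ)) : 𝓢'(ℝ, ℂ)) = c • (v : 𝓢'(ℝ, ℂ)) :=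
  map_smul (Lp.toTemperedDistributionCLM ℂ volume 2) c v

theorem l2Norm_coe (w : Lp ℂ 2 (volume : Measure ℝ)) : l2Norm (w : 𝓢'(ℝ, ℂ)) = ‖w‖ₑ := by
  refine le_antisymm ?_ (le_iInf₂ fun v hv => ?_)
  · exact iInf₂_le (f := fun (v : Lp ℂ 2 (volume : Measure ℝ))
      (_ : (v : 𝓢'(ℝ, ℂ)) = (w : 𝓢'(ℝ, ℂ))) => ‖v‖ₑ) w rfl
  · rw [l2_ext hv]

/-- The inner product conjugates v while the pairing does not; reality of v removes the difference.
-/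
theorem inner_toLp_eq_apply {v : Lp ℂ 2 (volume : Measure ℝ)} (hv : IsReal (v : 𝓢'(ℝ, ℂ)))
    (η : 𝓢(ℝ, ℂ)) : inner ℂ v (η.toLp 2 volume) = (v : 𝓢'(ℝ, ℂ)) η := by
  rw [← conjS_conjS η, hv.apply_conjS, conjS_conjS, Lp.toTemperedDistribution_apply,
    ← integral_conj, L2.inner_def]
  refine integral_congr_ae ?_
  filter_upwards [η.coeFn_toLp 2 volume] with x hx
  rw [hx]
  simp [mul_comm]

theorem norm_toLp_sq_eq_apply (η : 𝓢(ℝ, ℂ)) :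
    ‖η.toLp 2 volume‖ ^ 2 = ((η : 𝓢'(ℝ, ℂ)) (conjS η)).re := by
  rw [← inner_self_eq_norm_sq (𝕜 := ℂ), SchwartzMap.inner_toL2_toL2_eq η η volume,
    SchwartzMap.coe_apply]
  change (∫ x, inner ℂ (η x) (η x)).re = _
  congr 2
  ext x
  simp [mul_comm, Complex.mul_conj']

section Transpose

variable {L : 𝓢'(ℝ, ℂ) →L[ℂ] 𝓢'(ℝ, ℂ)} {T : 𝓢(ℝ, ℂ) →ₗ[ℂ] 𝓢(ℝ, ℂ)} {Lhat : ℝ → ℂ}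
  {ρ : 𝓢'(ℝ, ℂ)}

/-- The L₂ norm of η is controlled by `T η` alone, through a jointly continuous form; this drives
both limit arguments below. -/
theorem norm_toLp_sq_eq_correlate (hT : IsTranspose L T) (hL : ∀ f, IsReal f → IsReal (L f))
    (hLhat : IsFrequencyResponse L Lhat) (hρ : IsGreenAdjointSelf L ρ) (η : 𝓢(ℝ, ℂ)) :
    ‖η.toLp 2 volume‖ ^ 2 = (correlate ρ (T η) (conjS (T η))).re := by
  rw [norm_toLp_sq_eq_apply, ← apply_correlate_transpose hT hLhat hρ, hT, hT.conjS_comm hL]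

/-- The correlation of the Green's function with a Schwartz function orthogonal to the null space
has a square-integrable image under `L`, which reproduces the pairing with that Schwartz
function. -/
theorem exists_l2_correlate (hT : IsTranspose L T) (hL : ∀ f, IsReal f → IsReal (L f))
    (hLhat : IsFrequencyResponse L Lhat) (hρ : IsGreenAdjointSelf L ρ) {ψ : 𝓢(ℝ, ℂ)}
    (hψ : ψ ∈ orthNull L) :
    ∃ w : Lp ℂ 2 (volume : Measure ℝ), (w : 𝓢'(ℝ, ℂ)) = L (correlate ρ ψ) ∧
      ‖w‖ ^ 2 = (correlate ρ ψ (conjS ψ)).re ∧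
      ∀ f, IsReal f → ∀ v : Lp ℂ 2 (volume : Measure ℝ), (v : 𝓢'(ℝ, ℂ)) = L f →
        f ψ = inner ℂ v w := by
  obtain ⟨x, hx, hlim⟩ := mem_closure_iff_seq_limit.1 (mem_closure_range_transpose hT hL hψ)
  choose η hη using hx
  have hlim' : Tendsto (fun n => T (η n)) atTop (𝓝 ψ) := by simpa only [hη] using hlim
  let y : ℕ → Lp ℂ 2 (volume : Measure ℝ) := fun n => (η n).toLp 2 volume
  have hcauchy : CauchySeq y := by
    rw [cauchySeq_iff_tendsto_dist_atTop_0]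
    -- The η n need not converge as Schwartz functions, but the differences of their images under
    -- `T` tend to 0, so they are Cauchy in L₂.
    have h1 : Tendsto (fun n : ℕ × ℕ => T (η n.1) - T (η n.2)) atTop (𝓝 0) := by
      rw [← sub_self ψ, ← prod_atTop_atTop_eq]
      exact (hlim'.comp tendsto_fst).sub (hlim'.comp tendsto_snd)
    have h2 : Tendsto (fun n : ℕ × ℕ => conjS (T (η n.1) - T (η n.2))) atTop (𝓝 0) := by
      have := (conjS.continuous.tendsto 0).comp h1
      rwa [map_zero] at this
    have h3 := (Real.continuous_sqrt.comp Complex.continuous_re).tendsto 0 |>.comp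
      (tendsto_correlate_zero ρ h1 h2)
    simp only [Function.comp_def, Complex.zero_re, Real.sqrt_zero] at h3
    refine h3.congr fun n => ?_
    have h4 : y n.1 - y n.2 = (η n.1 - η n.2).toLp 2 volume :=
      (map_sub (SchwartzMap.toLpCLM ℂ ℂ 2 volume) (η n.1) (η n.2)).symm
    rw [dist_eq_norm, h4, ← Real.sqrt_sq (norm_nonneg _),
      norm_toLp_sq_eq_correlate hT hL hLhat hρ, map_sub T]
  obtain ⟨w, hw⟩ := cauchySeq_tendsto_of_complete hcauchy
  refine ⟨w, ?_, ?_, fun f hf v hv => ?_⟩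
  · have h1 : Tendsto (fun n => ((y n : Lp ℂ 2 (volume : Measure ℝ)) : 𝓢'(ℝ, ℂ))) atTop
        (𝓝 (w : 𝓢'(ℝ, ℂ))) :=
      ((Lp.toTemperedDistributionCLM ℂ volume 2).continuous.tendsto w).comp hw
    have h2 := (L.continuous.comp (continuous_correlate ρ)).tendsto ψ |>.comp hlim'
    refine tendsto_nhds_unique h1 (h2.congr fun n => ?_)
    simp only [Function.comp_apply]
    rw [apply_correlate_transpose hT hLhat hρ]
    exact (Lp.toTemperedDistribution_toLp_eq (η n)).symm
  · have h1 := (hw.norm).pow 2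
    have h2 := (Complex.continuous_re.tendsto _).comp
      (tendsto_correlate ρ hlim' ((conjS.continuous.tendsto ψ).comp hlim'))
    refine tendsto_nhds_unique h1 (h2.congr fun n => ?_)
    exact (norm_toLp_sq_eq_correlate hT hL hLhat hρ (η n)).symm
  · have h1 := ((map_continuous f).tendsto ψ).comp hlim'
    have h2 : Tendsto (fun n => inner ℂ v (y n)) atTop (𝓝 (inner ℂ v w)) :=
      ((innerSL ℂ v).continuous.tendsto w).comp hw
    refine tendsto_nhds_unique h1 (h2.congr fun n => ?_)
    -- Along the sequence, f(Tηₙ) = (Lf)(ηₙ) = ⟨v, ηₙ⟩.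
    rw [inner_toLp_eq_apply (by rw [hv]; exact hL f hf), hv, hT]
    rfl

theorem sub_sum_smul_mem_orthNull {N₀ : ℕ} (p : Module.Basis (Fin N₀) ℝ (nullSpace L))
    {κ : Fin N₀ → 𝓢(ℝ, ℂ)}
    (hκ : ∀ i j, ((p i : X2 L) : 𝓢'(ℝ, ℂ)) (κ j) = if i = j then 1 else 0) (ψ : 𝓢(ℝ, ℂ)) :
    ψ - ∑ n, ((p n : X2 L) : 𝓢'(ℝ, ℂ)) ψ • κ n ∈ orthNull L := by
  have h1 (i : Fin N₀) : ((p i : X2 L) : 𝓢'(ℝ, ℂ))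
      (ψ - ∑ n, ((p n : X2 L) : 𝓢'(ℝ, ℂ)) ψ • κ n) = 0 := by
    rw [map_sub, map_sum]
    simp [hκ]
  intro q
  rw [← p.sum_repr q]
  simp only [Submodule.coe_sum, Submodule.coe_smul]
  simp [h1]

/-- `L` maps the real tempered distributions onto a set containing the real square-integrable
functions. -/
theorem exists_apply_eq_l2 (hT : IsTranspose L T) (hL : ∀ f, IsReal f → IsReal (L f))
    (hLhat : IsFrequencyResponse L Lhat) (hρ : IsGreenAdjointSelf L ρ) {N₀ : ℕ}
    (p : Module.Basis (Fin N₀) ℝ (nullSpace L)) {κ : Fin N₀ → 𝓢(ℝ, ℂ)}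
    (hκ : ∀ i j, ((p i : X2 L) : 𝓢'(ℝ, ℂ)) (κ j) = if i = j then 1 else 0)
    {v : Lp ℂ 2 (volume : Measure ℝ)} (hv : IsReal (v : 𝓢'(ℝ, ℂ))) :
    ∃ f, IsReal f ∧ L f = (v : 𝓢'(ℝ, ℂ)) := by
  -- `P` is the continuous projection onto `orthNull L` along the `κ n`.
  let P : 𝓢(ℝ, ℂ) →ₗ[ℂ] 𝓢(ℝ, ℂ) := LinearMap.id -
    ∑ n, (((p n : X2 L) : 𝓢'(ℝ, ℂ)) : 𝓢(ℝ, ℂ) →ₗ[ℂ] ℂ).smulRight (κ n)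
  have hP_apply (ψ : 𝓢(ℝ, ℂ)) : P ψ = ψ - ∑ n, ((p n : X2 L) : 𝓢'(ℝ, ℂ)) ψ • κ n := by
    simp [P]
  have hP_cont : Continuous P := by
    simp_rw [continuous_congr hP_apply]
    exact continuous_id.sub (continuous_finsetSum _ fun n _ =>
      (map_continuous ((p n : X2 L) : 𝓢'(ℝ, ℂ))).smul continuous_const)
  have hP_mem (ψ : 𝓢(ℝ, ℂ)) : P ψ ∈ orthNull L := by
    rw [hP_apply]
    exact sub_sum_smul_mem_orthNull p hκ ψ
  have hP_eq {ψ : 𝓢(ℝ, ℂ)} (hψ : ψ ∈ orthNull L) : P ψ = ψ := by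
    rw [hP_apply]
    simp [fun n => hψ (p n)]
  -- `Q` is a left inverse of `T` with values in L₂, so the functional ψ ↦ ⟨v, Qψ⟩ solves Lf = v.
  choose Q hQ hQn _ using fun ψ : 𝓢(ℝ, ℂ) => exists_l2_correlate hT hL hLhat hρ (hP_mem ψ)
  have hQT (η : 𝓢(ℝ, ℂ)) : Q (T η) = η.toLp 2 volume := by
    refine l2_ext ?_
    rw [hQ, hP_eq (hT.mem_orthNull η), apply_correlate_transpose hT hLhat hρ]
    exact (Lp.toTemperedDistribution_toLp_eq η).symm
  let Qₗ : 𝓢(ℝ, ℂ) →ₗ[ℂ] Lp ℂ 2 (volume : Measure ℝ) :=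
    { toFun := Q
      map_add' := fun ψ χ => l2_ext (by
        rw [coe_l2_add, hQ, hQ, hQ, map_add P, ← map_add L]
        exact congrArg L (map_add (correlateₗ ρ) _ _))
      map_smul' := fun c ψ => l2_ext (by
        rw [RingHom.id_apply, coe_l2_smul, hQ, hQ, map_smul P, ← map_smul L]
        exact congrArg L (map_smul (correlateₗ ρ) _ _)) }
  have hQ_cont : Continuous Qₗ := by
    refine continuous_of_continuousAt_zero Qₗ ?_
    have h1 : Tendsto P (𝓝 0) (𝓝 0) := by simpa using hP_cont.tendsto 0
    have h2 : Tendsto (fun ψ => conjS (P ψ)) (𝓝 0) (𝓝 0) := by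
      have := (conjS.continuous.tendsto 0).comp h1
      rwa [map_zero] at this
    have h3 := (Real.continuous_sqrt.comp Complex.continuous_re).tendsto 0 |>.comp
      (tendsto_correlate_zero ρ h1 h2)
    simp only [Function.comp_def, Complex.zero_re, Real.sqrt_zero] at h3
    rw [ContinuousAt, map_zero, tendsto_zero_iff_norm_tendsto_zero]
    refine h3.congr fun ψ => ?_
    rw [← hQn, Real.sqrt_sq (norm_nonneg _)]
    rfl
  let f : 𝓢'(ℝ, ℂ) := ContinuousLinearMap.toPointwiseConvergenceCLM ℂ (RingHom.id ℂ) 𝓢(ℝ, ℂ) ℂ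
    ((innerSL ℂ v) ∘L ⟨Qₗ, hQ_cont⟩)
  have hf : L f = (v : 𝓢'(ℝ, ℂ)) := by
    ext η
    rw [hT]
    change inner ℂ v (Q (T η)) = _
    rw [hQT, inner_toLp_eq_apply hv]
  refine ⟨_, isReal_add_conjD f, ?_⟩
  rw [map_smul, map_add, hT.conjD_comm hL, hf, (isReal_iff_conjD _).1 hv]
  ext η
  change (1 / 2 : ℂ) * ((v : 𝓢'(ℝ, ℂ)) η + (v : 𝓢'(ℝ, ℂ)) η) = (v : 𝓢'(ℝ, ℂ)) η
  ring

end Transpose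

/-! ### Tikhonov functionals on Hilbert spaces -/

section Hilbert

variable {V K : Type*} [NormedAddCommGroup V] [InnerProductSpace ℝ V]
  [NormedAddCommGroup K] [NormedSpace ℝ K] {M : ℕ}

theorem IsCoercive.exists_norm_le {F : (Fin M → ℝ) → ℝ≥0∞} (hF : IsCoercive F) {c : ℝ≥0∞}
    (hc : c ≠ ⊤) : ∃ R : ℝ, ∀ u, F u ≤ c → ‖u‖ ≤ R := by
  have h1 : ∀ᶠ u in cocompact (Fin M → ℝ), c < F u := hF.eventually (lt_mem_nhds hc.lt_top)
  obtain ⟨t, ht, hsub⟩ := mem_cocompact.1 h1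
  obtain ⟨R, hR⟩ := ht.isBounded.exists_norm_le
  refine ⟨R, fun u hu => hR u ?_⟩
  by_contra hut
  exact absurd hu (not_le.2 (hsub hut))

/-- Sublevel sets are compact: the penalty bounds the `V` component, coercivity bounds `G x`, and
injectivity of `G` on `K` then bounds the `K` component. -/
theorem exists_minimizer_finiteDimensional [FiniteDimensional ℝ V] [FiniteDimensional ℝ K]
    (G : V × K →L[ℝ] (Fin M → ℝ)) (hG : ∀ k, G (0, k) = 0 → k = 0)
    {F : (Fin M → ℝ) → ℝ≥0∞} (hlsc : LowerSemicontinuous F) (hcoer : IsCoercive F)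
    {lam : ℝ} (hlam : 0 < lam) {x₀ : V × K} (hx₀ : F (G x₀) ≠ ⊤) :
    ∃ x : V × K, ∀ y : V × K, F (G x) + ENNReal.ofReal lam * ‖x.1‖ₑ ^ 2 ≤
      F (G y) + ENNReal.ofReal lam * ‖y.1‖ₑ ^ 2 := by
  have : ProperSpace (V × K) := FiniteDimensional.proper ℝ _
  set J : V × K → ℝ≥0∞ := fun x => F (G x) + ENNReal.ofReal lam * ‖x.1‖ₑ ^ 2 with hJ
  have hJlsc : LowerSemicontinuous J := by
    refine LowerSemicontinuous.add (hlsc.comp G.continuous) (Continuous.lowerSemicontinuous ?_)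
    exact ENNReal.continuous_const_mul ENNReal.ofReal_ne_top |>.comp
      ((ENNReal.continuous_pow 2).comp (continuous_enorm.comp continuous_fst))
  have hc : J x₀ ≠ ⊤ := ENNReal.add_ne_top.2
    ⟨hx₀, ENNReal.mul_ne_top ENNReal.ofReal_ne_top (ENNReal.pow_ne_top enorm_ne_top)⟩
  obtain ⟨R, hR⟩ := hcoer.exists_norm_le hc
  obtain ⟨A, hA, hanti⟩ := LinearMap.exists_antilipschitzWith
    (G.comp (ContinuousLinearMap.inr ℝ V K)).toLinearMap
    (LinearMap.ker_eq_bot'.2 fun k hk => hG k hk)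
  set D : ℝ := √((J x₀).toReal / lam) with hD
  have hbound : J ⁻¹' Set.Iic (J x₀) ⊆ Metric.closedBall 0 (max D (A * (R + ‖G‖ * D))) := by
    intro x (hx : J x ≤ J x₀)
    have h1 : ‖G x‖ ≤ R := hR _ (le_self_add.trans hx)
    have h2 : ‖x.1‖ ≤ D := by
      have h3 : ENNReal.ofReal lam * ‖x.1‖ₑ ^ 2 ≤ J x₀ := le_add_self.trans hx
      have h4 := ENNReal.toReal_mono hc h3
      rw [ENNReal.toReal_mul, ENNReal.toReal_pow, toReal_enorm, ENNReal.toReal_ofReal hlam.le]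
        at h4
      refine Real.le_sqrt_of_sq_le ?_
      rwa [le_div_iff₀ hlam, mul_comm]
    have h5 : ‖x.2‖ ≤ A * (R + ‖G‖ * D) := by
      have h6 : ‖x.2‖ ≤ A * ‖G (0, x.2)‖ := by
        have := hanti.le_mul_dist x.2 0
        rwa [map_zero, dist_zero_right, dist_zero_right] at this
      refine h6.trans (mul_le_mul_of_nonneg_left ?_ A.coe_nonneg)
      have h7 : G (0, x.2) = G x - G (x.1, 0) := by
        rw [← map_sub]; congr 1; ext <;> simp
      rw [h7]
      refine (norm_sub_le _ _).trans (add_le_add h1 ((G.le_opNorm _).trans ?_))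
      refine mul_le_mul_of_nonneg_left ?_ (norm_nonneg _)
      simpa [Prod.norm_def] using h2
    rw [mem_closedBall_zero_iff, Prod.norm_def]
    exact max_le_max h2 h5
  have hcomp : IsCompact (J ⁻¹' Set.Iic (J x₀)) :=
    Metric.isCompact_of_isClosed_isBounded (hJlsc.isClosed_preimage _)
      (Metric.isBounded_closedBall.subset hbound)
  obtain ⟨x, hx, hmin⟩ := LowerSemicontinuousOn.exists_isMinOn ⟨x₀, le_refl (J x₀)⟩ hcomp
    (hJlsc.lowerSemicontinuousOn _)
  refine ⟨x, fun y => ?_⟩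
  rcases le_total (J y) (J x₀) with h | h
  · exact hmin h
  · exact le_trans hx h

/-- Projecting the `V` component onto the orthogonal complement of ker G(·, 0) keeps `G` and does
not increase the norm. That complement is finite-dimensional because `G` embeds it in ℝ^M. -/
theorem exists_minimizer_hilbert [CompleteSpace V] [FiniteDimensional ℝ K]
    (G : V × K →L[ℝ] (Fin M → ℝ)) (hG : ∀ k, G (0, k) = 0 → k = 0)
    {F : (Fin M → ℝ) → ℝ≥0∞} (hlsc : LowerSemicontinuous F) (hcoer : IsCoercive F)
    {lam : ℝ} (hlam : 0 < lam) {x₀ : V × K} (hx₀ : F (G x₀) ≠ ⊤) :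
    ∃ x : V × K, ∀ y : V × K, F (G x) + ENNReal.ofReal lam * ‖x.1‖ₑ ^ 2 ≤
      F (G y) + ENNReal.ofReal lam * ‖y.1‖ₑ ^ 2 := by
  let G₁ : V →L[ℝ] (Fin M → ℝ) := G.comp (ContinuousLinearMap.inl ℝ V K)
  let U : Submodule ℝ V := LinearMap.ker G₁.toLinearMap
  have : CompleteSpace U := G₁.isClosed_ker.completeSpace_coe
  let W : Submodule ℝ V := Uᗮ
  have hWfin : FiniteDimensional ℝ W := by
    refine FiniteDimensional.of_injective (G₁.toLinearMap.comp W.subtype) ?_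
    rw [← LinearMap.ker_eq_bot, LinearMap.ker_eq_bot']
    intro w hw
    have h1 : (w : V) ∈ U ⊓ Uᗮ := ⟨hw, w.2⟩
    rw [Submodule.inf_orthogonal_eq_bot, Submodule.mem_bot] at h1
    exact Subtype.ext h1
  let G' : W × K →L[ℝ] (Fin M → ℝ) :=
    G.comp (W.subtypeL.prodMap (ContinuousLinearMap.id ℝ K))
  have hG' (w : W) (k : K) : G' (w, k) = G (w, k) := rfl
  have hproj (x : V × K) : G' (W.orthogonalProjectionOnto x.1, x.2) = G x := by
    have h1 : x.1 - W.orthogonalProjectionOnto x.1 ∈ U := by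
      have := W.sub_starProjection_mem_orthogonal x.1
      rwa [Submodule.orthogonal_orthogonal] at this
    have h2 : G (x.1 - W.orthogonalProjectionOnto x.1, 0) = 0 := h1
    rw [hG', eq_comm, ← sub_eq_zero, ← map_sub, ← h2]
    congr 1
    ext <;> simp
  obtain ⟨x, hx⟩ := exists_minimizer_finiteDimensional G' (fun k hk => hG k hk) hlsc hcoer hlam
    (x₀ := (W.orthogonalProjectionOnto x₀.1, x₀.2)) (by rwa [hproj])
  refine ⟨(x.1, x.2), fun y => (hx (W.orthogonalProjectionOnto y.1, y.2)).trans ?_⟩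
  rw [hproj]
  gcongr
  rw [← ofReal_norm, ← ofReal_norm]
  exact ENNReal.ofReal_le_ofReal (W.norm_orthogonalProjectionOnto_apply_le y.1)

theorem inner_eq_zero_of_forall_norm_le {v w : V} (h : ∀ t : ℝ, ‖v‖ ≤ ‖v + t • w‖) :
    inner ℝ v w = 0 := by
  have h1 (t : ℝ) : 0 ≤ 2 * t * inner ℝ v w + t ^ 2 * ‖w‖ ^ 2 := by
    have h2 := pow_le_pow_left₀ (norm_nonneg v) (h t) 2
    rw [norm_add_sq_real, inner_smul_right, norm_smul, mul_pow, Real.norm_eq_abs, sq_abs] at h2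
    linarith
  by_contra hne
  have h3 : 0 < (inner ℝ v w : ℝ) ^ 2 := by positivity
  have h4 : (0 : ℝ) < ‖w‖ ^ 2 + 1 := by positivity
  -- Near the minimum of the quadratic in t; the added 1 keeps the denominator positive.
  have h5 := h1 (-(inner ℝ v w) / (‖w‖ ^ 2 + 1))
  have h6 : 2 * (-(inner ℝ v w : ℝ) / (‖w‖ ^ 2 + 1)) * inner ℝ v w +
      (-(inner ℝ v w : ℝ) / (‖w‖ ^ 2 + 1)) ^ 2 * ‖w‖ ^ 2 =
      -((inner ℝ v w : ℝ) ^ 2 * (‖w‖ ^ 2 + 2)) / (‖w‖ ^ 2 + 1) ^ 2 := by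
    field_simp
    ring
  rw [h6] at h5
  have h7 : -((inner ℝ v w : ℝ) ^ 2 * (‖w‖ ^ 2 + 2)) / (‖w‖ ^ 2 + 1) ^ 2 < 0 := by
    apply div_neg_of_neg_of_pos
    · have : 0 < (inner ℝ v w : ℝ) ^ 2 * (‖w‖ ^ 2 + 2) := by positivity
      linarith
    · positivity
  linarith

/-- Two minimizers of a Tikhonov functional with a strictly convex data term coincide. -/
theorem eq_of_minimizers {X : Type*} [AddCommGroup X] [Module ℝ X] (A : X →ₗ[ℝ] V)
    (H : X →ₗ[ℝ] (Fin M → ℝ)) {F : (Fin M → ℝ) → ℝ≥0∞} (hF : IsStrictlyConvex F)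
    {lam : ℝ} (hlam : 0 < lam) {f g : X}
    (hinj : A f = A g → H f = H g → f = g) (hfin : F (H f) ≠ ⊤) (hgin : F (H g) ≠ ⊤)
    (hf : ∀ k, F (H f) + ENNReal.ofReal lam * ‖A f‖ₑ ^ 2 ≤
      F (H k) + ENNReal.ofReal lam * ‖A k‖ₑ ^ 2)
    (hg : ∀ k, F (H g) + ENNReal.ofReal lam * ‖A g‖ₑ ^ 2 ≤
      F (H k) + ENNReal.ofReal lam * ‖A k‖ₑ ^ 2) : f = g := by
  have hq (x : X) : ENNReal.ofReal lam * ‖A x‖ₑ ^ 2 = ENNReal.ofReal (lam * ‖A x‖ ^ 2) := by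
    rw [ENNReal.ofReal_mul hlam.le, ENNReal.ofReal_pow (norm_nonneg _), ofReal_norm]
  simp only [hq] at hf hg
  have hreal {x : X} (hx : F (H x) ≠ ⊤) : F (H x) + ENNReal.ofReal (lam * ‖A x‖ ^ 2) =
      ENNReal.ofReal ((F (H x)).toReal + lam * ‖A x‖ ^ 2) := by
    rw [ENNReal.ofReal_add ENNReal.toReal_nonneg (by positivity), ENNReal.ofReal_toReal hx]
  set k : X := (1 / 2 : ℝ) • f + (1 / 2 : ℝ) • g with hk
  have hHk : H k = (1 / 2 : ℝ) • H f + (1 / 2 : ℝ) • H g := by simp [hk]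
  have hAk : A k = (1 / 2 : ℝ) • (A f + A g) := by simp [hk]
  -- At the midpoint the penalty gains a quarter of ‖Af - Ag‖², which forces Af = Ag; strict
  -- convexity handles the data term.
  have hnorm : ‖A k‖ ^ 2 = 1 / 2 * (‖A f‖ ^ 2 + ‖A g‖ ^ 2) - 1 / 4 * ‖A f - A g‖ ^ 2 := by
    have h1 := parallelogram_law_with_norm ℝ (A f) (A g)
    rw [hAk, norm_smul]
    norm_num
    nlinarith
  have hle : F (H k) ≠ ⊤ ∧
      (F (H k)).toReal ≤ 1 / 2 * ((F (H f)).toReal + (F (H g)).toReal) ∧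
      (H f ≠ H g → (F (H k)).toReal < 1 / 2 * ((F (H f)).toReal + (F (H g)).toReal)) := by
    rcases eq_or_ne (H f) (H g) with h | h
    · have h1 : H k = H f := by rw [hHk, ← h, ← add_smul]; norm_num
      rw [h1, ← h]
      exact ⟨hfin, by linarith, fun h2 => absurd rfl h2⟩
    · have h1 := hF _ _ h hfin hgin (1 / 2) (1 / 2) (by norm_num) (by norm_num) (by norm_num)
      rw [← hHk] at h1
      have hrhs : ENNReal.ofReal (1 / 2) * F (H f) + ENNReal.ofReal (1 / 2) * F (H g) =
          ENNReal.ofReal (1 / 2 * ((F (H f)).toReal + (F (H g)).toReal)) := by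
        rw [mul_add, ENNReal.ofReal_add (by positivity) (by positivity),
          ENNReal.ofReal_mul (by norm_num), ENNReal.ofReal_mul (by norm_num),
          ENNReal.ofReal_toReal hfin, ENNReal.ofReal_toReal hgin]
      rw [hrhs] at h1
      have h2 : F (H k) ≠ ⊤ := h1.ne_top
      have h3 := (ENNReal.lt_ofReal_iff_toReal_lt h2).1 h1
      exact ⟨h2, h3.le, fun _ => h3⟩
  obtain ⟨hkfin, hkle, hklt⟩ := hle
  have h1 := hf k
  have h2 := hg k
  rw [hreal hfin, hreal hkfin, ENNReal.ofReal_le_ofReal_iff (by positivity)] at h1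
  rw [hreal hgin, hreal hkfin, ENNReal.ofReal_le_ofReal_iff (by positivity)] at h2
  rw [hnorm] at h1 h2
  have h3 : 0 ≤ lam * ‖A f - A g‖ ^ 2 := by positivity
  have hH : H f = H g := by
    by_contra hne
    have := hklt hne
    linarith
  have h4 : lam * ‖A f - A g‖ ^ 2 = 0 := by linarith
  have h5 : A f = A g := by
    have h6 : ‖A f - A g‖ ^ 2 = 0 := (mul_eq_zero.1 h4).resolve_left hlam.ne'
    exact sub_eq_zero.1 (norm_eq_zero.1 (pow_eq_zero_iff (two_ne_zero) |>.1 h6))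
  exact hinj h5 hH

end Hilbert

/-! ### The search space as a Hilbert space -/

theorem real_smul_eq (c : ℝ) (f : 𝓢'(ℝ, ℂ)) : c • f = (c : ℂ) • f := by
  ext ψ; simp

/-- The real square-integrable functions. -/
def realL2 : Submodule ℝ (Lp ℂ 2 (volume : Measure ℝ)) where
  carrier := {w | IsReal (w : 𝓢'(ℝ, ℂ))}
  zero_mem' := fun ψ _ => by
    rw [← Lp.toTemperedDistributionCLM_apply, map_zero]
    rfl
  add_mem' := fun {v w} hv hw ψ hψ => by
    rw [coe_l2_add]
    change ((v : 𝓢'(ℝ, ℂ)) ψ + (w : 𝓢'(ℝ, ℂ)) ψ).im = 0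
    rw [Complex.add_im, hv ψ hψ, hw ψ hψ, add_zero]
  smul_mem' := fun c v hv ψ hψ => by
    rw [RCLike.real_smul_eq_coe_smul (K := ℂ) c v, coe_l2_smul]
    change ((c : ℂ) * (v : 𝓢'(ℝ, ℂ)) ψ).im = 0
    rw [Complex.im_ofReal_mul, hv ψ hψ, mul_zero]

theorem mem_realL2 {w : Lp ℂ 2 (volume : Measure ℝ)} :
    w ∈ realL2 ↔ IsReal (w : 𝓢'(ℝ, ℂ)) := Iff.rfl

theorem isClosed_realL2 : IsClosed (realL2 : Set (Lp ℂ 2 (volume : Measure ℝ))) := by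
  have h1 : (realL2 : Set (Lp ℂ 2 (volume : Measure ℝ))) =
      ⋂ (ψ : 𝓢(ℝ, ℂ)) (_ : IsRealTest ψ),
        {w | (Lp.toTemperedDistributionCLM ℂ volume 2 w ψ).im = 0} := by
    ext w
    simp only [Set.mem_iInter]
    rfl
  rw [h1]
  refine isClosed_iInter fun ψ => isClosed_iInter fun _ => isClosed_eq ?_ continuous_const
  exact Complex.continuous_im.comp
    ((PointwiseConvergenceCLM.evalCLM (RingHom.id ℂ) ℂ ψ).continuous.comp
      (Lp.toTemperedDistributionCLM ℂ volume 2).continuous)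

instance : CompleteSpace realL2 := isClosed_realL2.completeSpace_coe

theorem real_inner_l2_eq_re (v w : Lp ℂ 2 (volume : Measure ℝ)) :
    inner ℝ v w = (inner ℂ v w).re := by
  rw [L2.inner_def, L2.inner_def]
  exact integral_re (L2.integrable_inner (𝕜 := ℂ) v w)

section SearchSpace

variable {L : 𝓢'(ℝ, ℂ) →L[ℂ] 𝓢'(ℝ, ℂ)}

theorem exists_l2_eq (hL : ∀ f, IsReal f → IsReal (L f)) (f : X2 L) :
    ∃ w : realL2, ((w : Lp ℂ 2 (volume : Measure ℝ)) : 𝓢'(ℝ, ℂ)) = L f := by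
  obtain ⟨w, hw⟩ := (l2Norm_lt_top_iff _).1 f.2.2
  exact ⟨⟨w, by rw [mem_realL2, hw]; exact hL _ f.2.1⟩, hw⟩

/-- The real square-integrable function that represents `L f`. -/
def l2Rep (hL : ∀ f, IsReal f → IsReal (L f)) (f : X2 L) : realL2 :=
  (exists_l2_eq hL f).choose

theorem coe_l2Rep (hL : ∀ f, IsReal f → IsReal (L f)) (f : X2 L) :
    ((l2Rep hL f : Lp ℂ 2 (volume : Measure ℝ)) : 𝓢'(ℝ, ℂ)) = L f :=
  (exists_l2_eq hL f).choose_spec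

/-- The operator `L` from the search space to the real square-integrable functions. -/
def l2Image (hL : ∀ f, IsReal f → IsReal (L f)) : X2 L →ₗ[ℝ] realL2 where
  toFun := l2Rep hL
  map_add' f g := Subtype.ext <| l2_ext <| by
    rw [Submodule.coe_add, coe_l2_add, coe_l2Rep, coe_l2Rep, coe_l2Rep, ← map_add]
    rfl
  map_smul' c f := Subtype.ext <| l2_ext <| by
    rw [Submodule.coe_smul, RCLike.real_smul_eq_coe_smul (K := ℂ) (RingHom.id ℝ c), coe_l2_smul,
      coe_l2Rep, coe_l2Rep, ← map_smul]
    exact congrArg L (real_smul_eq c f)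

theorem coe_l2Image (hL : ∀ f, IsReal f → IsReal (L f)) (f : X2 L) :
    ((l2Image hL f : Lp ℂ 2 (volume : Measure ℝ)) : 𝓢'(ℝ, ℂ)) = L f :=
  coe_l2Rep hL f

theorem l2Norm_apply (hL : ∀ f, IsReal f → IsReal (L f)) (f : X2 L) :
    l2Norm (L f) = ‖l2Image hL f‖ₑ := by
  rw [← coe_l2Image hL, l2Norm_coe]
  rfl

theorem l2Image_eq_zero_iff (hL : ∀ f, IsReal f → IsReal (L f)) (f : X2 L) :
    l2Image hL f = 0 ↔ f ∈ nullSpace L := by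
  refine ⟨fun h => ?_, fun h => Subtype.ext (l2_ext ?_)⟩
  · change L f = 0
    rw [← coe_l2Image hL, h, Submodule.coe_zero, ← Lp.toTemperedDistributionCLM_apply, map_zero]
  · rw [coe_l2Image, show L f = 0 from h, Submodule.coe_zero, ← Lp.toTemperedDistributionCLM_apply,
      map_zero]

/-- The pairings of an element of the search space with Schwartz functions. -/
def pairings (L : 𝓢'(ℝ, ℂ) →L[ℂ] 𝓢'(ℝ, ℂ)) {N₀ : ℕ} (κ : Fin N₀ → 𝓢(ℝ, ℂ)) :
    X2 L →ₗ[ℝ] (Fin N₀ → ℝ) where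
  toFun f n := ((f : 𝓢'(ℝ, ℂ)) (κ n)).re
  map_add' f g := by ext n; exact Complex.add_re _ _
  map_smul' c f := by
    ext n
    change ((c • (f : 𝓢'(ℝ, ℂ))) (κ n)).re = c * _
    rw [real_smul_eq]
    exact Complex.re_ofReal_mul _ _

@[simp]
theorem pairings_apply {N₀ : ℕ} (κ : Fin N₀ → 𝓢(ℝ, ℂ)) (f : X2 L) (n : Fin N₀) :
    pairings L κ f n = ((f : 𝓢'(ℝ, ℂ)) (κ n)).re := rfl

variable {T : 𝓢(ℝ, ℂ) →ₗ[ℂ] 𝓢(ℝ, ℂ)} {Lhat : ℝ → ℂ} {ρ : 𝓢'(ℝ, ℂ)} {N₀ : ℕ}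

theorem pairings_sum (p : Module.Basis (Fin N₀) ℝ (nullSpace L)) {κ : Fin N₀ → 𝓢(ℝ, ℂ)}
    (hκ : ∀ i j, ((p i : X2 L) : 𝓢'(ℝ, ℂ)) (κ j) = if i = j then 1 else 0) (c : Fin N₀ → ℝ) :
    pairings L κ (∑ n, c n • (p n : X2 L)) = c := by
  rw [map_sum]
  ext j
  simp [hκ, apply_ite Complex.re]

/-- The kernel of `L` is parametrized by the pairings with κ, by biorthogonality. Surjectivity
solves Lg = v and then corrects the pairings by a null-space element. -/
theorem bijective_l2Image_prod_pairings (hT : IsTranspose L T)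
    (hL : ∀ f, IsReal f → IsReal (L f)) (hLhat : IsFrequencyResponse L Lhat)
    (hρ : IsGreenAdjointSelf L ρ) (p : Module.Basis (Fin N₀) ℝ (nullSpace L))
    {κ : Fin N₀ → 𝓢(ℝ, ℂ)}
    (hκ : ∀ i j, ((p i : X2 L) : 𝓢'(ℝ, ℂ)) (κ j) = if i = j then 1 else 0) :
    Function.Bijective ((l2Image hL).prod (pairings L κ)) := by
  constructor
  · rw [← LinearMap.ker_eq_bot, LinearMap.ker_eq_bot']
    intro f hf
    obtain ⟨h1, h2⟩ := Prod.mk.inj hf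
    have h3 := p.sum_repr ⟨f, (l2Image_eq_zero_iff hL f).1 h1⟩
    set c := p.repr ⟨f, (l2Image_eq_zero_iff hL f).1 h1⟩
    have h4 : ∑ n, c n • (p n : X2 L) = f := by
      simpa only [Submodule.coe_sum, Submodule.coe_smul] using congrArg Subtype.val h3
    have h5 : (c : Fin N₀ → ℝ) = 0 := by
      rw [← pairings_sum p hκ c, h4]
      exact h2
    rw [← h4]
    simp [h5]
  · rintro ⟨v, c⟩
    obtain ⟨f, hf, hLf⟩ := exists_apply_eq_l2 hT hL hLhat hρ p hκ (mem_realL2.1 v.2)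
    let g : X2 L := ⟨f, hf, by rw [hLf]; exact (l2Norm_lt_top_iff _).2 ⟨_, rfl⟩⟩
    have hg : l2Image hL g = v := Subtype.ext (l2_ext ((coe_l2Image hL g).trans hLf))
    refine ⟨g + ∑ n, (c - pairings L κ g) n • (p n : X2 L), Prod.ext ?_ ?_⟩
    · change l2Image hL _ = v
      rw [map_add, hg, map_sum]
      simp only [map_smul, (l2Image_eq_zero_iff hL _).2 (p _).2]
      simp
    · change pairings L κ _ = c
      rw [map_add, pairings_sum p hκ, add_sub_cancel]

/-- The representer of the pairing with a real Schwartz function orthogonal to the null space. -/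
theorem correlate_mem_X2 (hT : IsTranspose L T) (hL : ∀ f, IsReal f → IsReal (L f))
    (hLhat : IsFrequencyResponse L Lhat) (hρ : IsGreenAdjointSelf L ρ) {ψ : 𝓢(ℝ, ℂ)}
    (hψr : IsRealTest ψ) (hψ : ψ ∈ orthNull L) : correlate ρ ψ ∈ X2 L := by
  obtain ⟨w, hw, -⟩ := exists_l2_correlate hT hL hLhat hρ hψ
  exact ⟨isReal_correlate hρ.1 hψr, (l2Norm_lt_top_iff _).2 ⟨w, hw⟩⟩

/-- The reproducing property: `correlate ρ ψ` is the Riesz representer of evaluation at ψ for the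
seminorm ‖Lf‖. -/
theorem apply_eq_inner_correlate (hT : IsTranspose L T) (hL : ∀ f, IsReal f → IsReal (L f))
    (hLhat : IsFrequencyResponse L Lhat) (hρ : IsGreenAdjointSelf L ρ) {ψ : 𝓢(ℝ, ℂ)}
    (hψr : IsRealTest ψ) (hψ : ψ ∈ orthNull L) (hmem : correlate ρ ψ ∈ X2 L) (f : X2 L) :
    (f : 𝓢'(ℝ, ℂ)) ψ = ((inner ℝ (l2Image hL f) (l2Image hL ⟨correlate ρ ψ, hmem⟩) : ℝ) : ℂ) := by
  obtain ⟨w, hw, -, hinner⟩ := exists_l2_correlate hT hL hLhat hρ hψ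
  have h1 : (l2Image hL ⟨correlate ρ ψ, hmem⟩ : Lp ℂ 2 (volume : Measure ℝ)) = w :=
    l2_ext ((coe_l2Image hL _).trans hw.symm)
  have h2 := hinner f f.2.1 _ (coe_l2Image hL f)
  rw [Submodule.coe_inner, h1, real_inner_l2_eq_re, ← h2]
  exact Complex.ext (by simp) (by simp [f.2.1 ψ hψr])

theorem distribution_ext_real {f g : 𝓢'(ℝ, ℂ)} (h : ∀ ψ, IsRealTest ψ → f ψ = g ψ) : f = g := by
  ext ψ
  rw [eq_re_add_im ψ]
  simp only [map_add f, map_add g, map_smul f Complex.I, map_smul g Complex.I,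
    h _ (isRealTest_add_conjS ψ), h _ (isRealTest_sub_conjS ψ)]

/-! ### Basis functions -/

theorem isRealTest_normal (hT : IsTranspose L T) (hL : ∀ f, IsReal f → IsReal (L f))
    {ψ : 𝓢(ℝ, ℂ)} (hψ : IsRealTest ψ) : IsRealTest (T (reflS (T (reflS ψ)))) := by
  have hreal {χ : 𝓢(ℝ, ℂ)} (hχ : IsRealTest χ) : IsRealTest (T (reflS χ)) := by
    have h1 : IsRealTest (reflS χ) := fun x => hχ (-x)
    rw [isRealTest_iff] at *
    rw [← hT.conjS_comm hL, h1]
  exact hreal (hreal hψ)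

/-- A real distribution that satisfies the duality relation of a convolution with the Green's
function is a basis function. -/
theorem isBasisFunction_of_convolution (hT : IsTranspose L T)
    (hL : ∀ f, IsReal f → IsReal (L f)) (hLhat : IsFrequencyResponse L Lhat)
    (hρ : IsGreenAdjointSelf L ρ) {h φ : 𝓢'(ℝ, ℂ)} {hX : X2 L → ℝ}
    (hh : ∀ ψ : 𝓢(ℝ, ℂ), IsRealTest ψ → ∀ hψ : (ψ : 𝓢'(ℝ, ℂ)) ∈ X2 L, h ψ = (hX ⟨ψ, hψ⟩ : ℂ))
    (hφ : IsReal φ)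
    (hconv : ∀ ψ : 𝓢(ℝ, ℂ), IsRealTest ψ → ψ ∈ orthNull L →
      ∃ hψ : correlate ρ ψ ∈ X2 L, φ ψ = (hX ⟨correlate ρ ψ, hψ⟩ : ℂ)) :
    IsBasisFunction L Lhat ρ h hX φ := by
  have hinv : adjoint L (L φ) = h := by
    refine distribution_ext_real fun ψ hψ => ?_
    rw [hT.adjoint_apply]
    -- The test function is the transpose of L*L applied to ψ, whose correlation with ρ is ψ itself.
    obtain ⟨hmem, heq⟩ := hconv _ (isRealTest_normal hT hL hψ) (hT.mem_orthNull _)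
    have h1 := correlate_normal hT hLhat hρ ψ
    rw [heq, hh ψ hψ (h1 ▸ hmem)]
    congr 3
  -- Multiplication by |Lhat|² is the transpose of L*L conjugated by the Fourier transform, hence
  -- preserves Schwartz functions.
  refine ⟨hφ, fun ψ => ⟨𝓕⁻ (T (reflS (T (reflS (𝓕 ψ))))), fun ξ => ?_, ?_⟩, hinv, hconv⟩
  · rw [hT.fourierInv_normal hLhat, FourierTransform.fourierInv_fourier_eq,
      hT.frequencyResponse_mul hLhat hL]
  · rw [TemperedDistribution.fourier_apply, TemperedDistribution.fourier_apply,
      FourierTransform.fourier_fourierInv_eq, ← hT.adjoint_apply, hinv]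

/-- The witness is f + ∑ cₙ (ρ * κₙ): the reproducing property matches f with the inner product, and
the symmetry of the correlation matches ρ * κₙ with the pairing against κₙ. -/
theorem exists_isBasisFunction (hT : IsTranspose L T)
    (hL : ∀ f, IsReal f → IsReal (L f)) (hLhat : IsFrequencyResponse L Lhat)
    (hρ : IsGreenAdjointSelf L ρ) {κ : Fin N₀ → 𝓢(ℝ, ℂ)} (hκr : ∀ n, IsRealTest (κ n))
    {h : 𝓢'(ℝ, ℂ)} {hX : X2 L → ℝ}
    (hh : ∀ ψ : 𝓢(ℝ, ℂ), IsRealTest ψ → ∀ hψ : (ψ : 𝓢'(ℝ, ℂ)) ∈ X2 L, h ψ = (hX ⟨ψ, hψ⟩ : ℂ))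
    {f : X2 L} {c : Fin N₀ → ℝ}
    (hrep : ∀ g, hX g = inner ℝ (l2Image hL f) (l2Image hL g) + ∑ n, c n * pairings L κ g n) :
    ∃ φ, IsBasisFunction L Lhat ρ h hX φ := by
  have happly (ψ : 𝓢(ℝ, ℂ)) : ((f : 𝓢'(ℝ, ℂ)) + ∑ n, (c n : ℂ) • correlate (reflect ρ) (κ n)) ψ =
      (f : 𝓢'(ℝ, ℂ)) ψ + ∑ n, (c n : ℂ) * correlate ρ ψ (κ n) := by
    simp [← correlate_reflect_apply ρ ψ]
  refine ⟨(f : 𝓢'(ℝ, ℂ)) + ∑ n, (c n : ℂ) • correlate (reflect ρ) (κ n),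
    isBasisFunction_of_convolution hT hL hLhat hρ hh (fun ψ hψ => ?_) fun ψ hψr hψ => ?_⟩
  · rw [happly]
    simp [f.2.1 ψ hψ, isReal_correlate hρ.1 hψ _ (hκr _)]
  · have hmem := correlate_mem_X2 hT hL hLhat hρ hψr hψ
    refine ⟨hmem, ?_⟩
    rw [happly, hrep, apply_eq_inner_correlate hT hL hLhat hρ hψr hψ hmem, Complex.ofReal_add,
      Complex.ofReal_sum]
    congr 1
    refine Finset.sum_congr rfl fun n _ => ?_
    rw [Complex.ofReal_mul, pairings_apply]
    congr 1
    exact Complex.ext (by simp) (by simp [isReal_correlate hρ.1 hψr _ (hκr n)])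

/-- A real distribution that annihilates the real Schwartz functions orthogonal to the null space
belongs to the null space. -/
theorem eq_sum_of_forall_orthNull (p : Module.Basis (Fin N₀) ℝ (nullSpace L))
    {κ : Fin N₀ → 𝓢(ℝ, ℂ)} (hκr : ∀ n, IsRealTest (κ n))
    (hκ : ∀ i j, ((p i : X2 L) : 𝓢'(ℝ, ℂ)) (κ j) = if i = j then 1 else 0)
    {u : 𝓢'(ℝ, ℂ)} (hu : IsReal u)
    (hzero : ∀ ψ : 𝓢(ℝ, ℂ), IsRealTest ψ → ψ ∈ orthNull L → u ψ = 0) :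
    u = ∑ n, (u (κ n)).re • ((p n : X2 L) : 𝓢'(ℝ, ℂ)) := by
  refine distribution_ext_real fun ψ hψ => ?_
  have hreal : IsRealTest (ψ - ∑ n, ((p n : X2 L) : 𝓢'(ℝ, ℂ)) ψ • κ n) := by
    intro x
    simp [hψ x, hκr _ x, (p _ : X2 L).2.1 ψ hψ]
  -- Vanishing on the projection of ψ expresses u(ψ) through the values u(κₙ).
  have h1 := hzero _ hreal (sub_sum_smul_mem_orthNull p hκ ψ)
  rw [map_sub, map_sum, sub_eq_zero] at h1
  have h2 (n : Fin N₀) : u (κ n) = ((u (κ n)).re : ℂ) :=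
    Complex.ext (by simp) (by simp [hu _ (hκr n)])
  rw [h1]
  simp only [map_smul, smul_eq_mul]
  simp_rw [real_smul_eq, ← h2]
  simp [mul_comm]

end SearchSpace

/-! ### The representer theorem -/

section Representer

variable {L : 𝓢'(ℝ, ℂ) →L[ℂ] 𝓢'(ℝ, ℂ)} {T : 𝓢(ℝ, ℂ) →ₗ[ℂ] 𝓢(ℝ, ℂ)} {Lhat : ℝ → ℂ}
  {ρ : 𝓢'(ℝ, ℂ)} {N₀ M : ℕ}

/-- The product carries the sup norm, and each of the 1 + N₀ squares is at most ‖x‖². -/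
theorem nativeNorm_le (hL : ∀ f, IsReal f → IsReal (L f)) (κ : Fin N₀ → 𝓢(ℝ, ℂ)) (f : X2 L) :
    nativeNorm L κ f ≤ √(1 + N₀) * ‖(l2Image hL f, pairings L κ f)‖ := by
  rw [nativeNorm, l2Norm_apply hL, toReal_enorm]
  set x := (l2Image hL f, pairings L κ f) with hx
  have h1 : ‖l2Image hL f‖ ≤ ‖x‖ := norm_fst_le x
  have h2 (n : Fin N₀) : ((f : 𝓢'(ℝ, ℂ)) (κ n)).re ^ 2 ≤ ‖x‖ ^ 2 := by
    have h3 : ‖pairings L κ f n‖ ≤ ‖x‖ := (norm_le_pi_norm _ n).trans (norm_snd_le x)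
    rw [← sq_abs]
    exact pow_le_pow_left₀ (abs_nonneg _) h3 2
  rw [← Real.sqrt_sq (norm_nonneg x), ← Real.sqrt_mul (by positivity)]
  refine Real.sqrt_le_sqrt ?_
  calc _ ≤ ‖x‖ ^ 2 + ∑ _n : Fin N₀, ‖x‖ ^ 2 :=
        add_le_add (pow_le_pow_left₀ (norm_nonneg _) h1 2) (Finset.sum_le_sum fun n _ => h2 n)
    _ = _ := by simp; ring

/-- A bounded measurement operator factors through a continuous linear map on the Hilbert space
that is isomorphic to the search space. -/
theorem exists_factorization (hL : ∀ f, IsReal f → IsReal (L f)) {κ : Fin N₀ → 𝓢(ℝ, ℂ)}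
    (hbij : Function.Bijective ((l2Image hL).prod (pairings L κ)))
    {H : X2 L →ₗ[ℝ] (Fin M → ℝ)} {C : ℝ} (hC : ∀ f, ‖H f‖ ≤ C * nativeNorm L κ f) :
    ∃ G : realL2 × (Fin N₀ → ℝ) →L[ℝ] (Fin M → ℝ),
      ∀ f, H f = G (l2Image hL f, pairings L κ f) := by
  let e := LinearEquiv.ofBijective _ hbij
  have he (f : X2 L) : e f = (l2Image hL f, pairings L κ f) := rfl
  refine ⟨(H.comp e.symm.toLinearMap).mkContinuous (|C| * √(1 + N₀)) fun x => ?_, fun f => ?_⟩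
  · obtain ⟨f, rfl⟩ := e.surjective x
    have h1 : H.comp e.symm.toLinearMap (e f) = H f := by simp
    rw [h1, mul_assoc, he]
    refine (hC f).trans ((mul_le_mul_of_nonneg_right (le_abs_self C) (Real.sqrt_nonneg _)).trans ?_)
    exact mul_le_mul_of_nonneg_left (nativeNorm_le hL κ f) (abs_nonneg C)
  · rw [← he]
    simp

/-- The Riesz representation of the measurements on the search space. -/
theorem exists_riesz (hL : ∀ f, IsReal f → IsReal (L f)) {κ : Fin N₀ → 𝓢(ℝ, ℂ)}
    (hbij : Function.Bijective ((l2Image hL).prod (pairings L κ)))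
    {H : X2 L →ₗ[ℝ] (Fin M → ℝ)} {G : realL2 × (Fin N₀ → ℝ) →L[ℝ] (Fin M → ℝ)}
    (hG : ∀ f, H f = G (l2Image hL f, pairings L κ f)) (m : Fin M) :
    ∃ (f : X2 L) (c : Fin N₀ → ℝ), ∀ g, H g m =
      inner ℝ (l2Image hL f) (l2Image hL g) + ∑ n, c n * pairings L κ g n := by
  let Gm : realL2 × (Fin N₀ → ℝ) →L[ℝ] ℝ := (ContinuousLinearMap.proj m).comp G
  -- The pairings of f are set to 0 arbitrarily; only `L f` matters.
  obtain ⟨f, hf⟩ := hbij.surjective ((InnerProductSpace.toDual ℝ realL2).symm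
    (Gm.comp (ContinuousLinearMap.inl ℝ realL2 (Fin N₀ → ℝ))), 0)
  have hf' : l2Image hL f = (InnerProductSpace.toDual ℝ realL2).symm
    (Gm.comp (ContinuousLinearMap.inl ℝ realL2 (Fin N₀ → ℝ))) := (Prod.mk.inj hf).1
  refine ⟨f, fun n => Gm (0, Pi.single n 1), fun g => ?_⟩
  have h1 : H g m = Gm (l2Image hL g, 0) + Gm (0, pairings L κ g) := by
    rw [← map_add, hG]
    simp [Gm]
  rw [h1, hf', InnerProductSpace.toDual_symm_apply]
  congr 1
  have h2 := LinearMap.pi_apply_eq_sum_univ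
    (Gm.comp (ContinuousLinearMap.inr ℝ realL2 (Fin N₀ → ℝ))).toLinearMap (pairings L κ g)
  refine h2.trans (Finset.sum_congr rfl fun n _ => ?_)
  rw [smul_eq_mul, mul_comm]
  congr 1
  refine congrArg (fun x => Gm (0, x)) ?_
  ext j
  simp [Pi.single_apply, eq_comm]

theorem cost_eq (hL : ∀ f, IsReal f → IsReal (L f)) (H : X2 L →ₗ[ℝ] (Fin M → ℝ))
    (E : (Fin M → ℝ) → (Fin M → ℝ) → ℝ≥0∞) (z : Fin M → ℝ) (lam : ℝ) (f : X2 L) :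
    cost L H E z lam f = E z (H f) + ENNReal.ofReal lam * ‖l2Image hL f‖ₑ ^ 2 := by
  rw [cost, l2Norm_apply hL]

theorem IsMinimizer.ne_top {H : X2 L →ₗ[ℝ] (Fin M → ℝ)} {E : (Fin M → ℝ) → (Fin M → ℝ) → ℝ≥0∞}
    {z : Fin M → ℝ} {lam : ℝ} (hEfeas : ∃ f : X2 L, E z (H f) ≠ ⊤) {f : X2 L}
    (hf : IsMinimizer (cost L H E z lam) f) : E z (H f) ≠ ⊤ := by
  obtain ⟨g, hg⟩ := hEfeas
  have h1 : cost L H E z lam g ≠ ⊤ := ENNReal.add_ne_top.2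
    ⟨hg, ENNReal.mul_ne_top ENNReal.ofReal_ne_top (ENNReal.pow_ne_top g.2.2.ne)⟩
  exact (ENNReal.add_ne_top.1 (ne_top_of_le_ne_top h1 (hf g))).1

/-- At a minimizer, the derivative of the regularization is a combination of the measurements. -/
theorem IsMinimizer.exists_inner_eq_sum (hL : ∀ f, IsReal f → IsReal (L f))
    {H : X2 L →ₗ[ℝ] (Fin M → ℝ)} {E : (Fin M → ℝ) → (Fin M → ℝ) → ℝ≥0∞}
    {z : Fin M → ℝ} {lam : ℝ} (hlam : 0 < lam) {f : X2 L}
    (hf : IsMinimizer (cost L H E z lam) f) (hfin : E z (H f) ≠ ⊤) :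
    ∃ a : Fin M → ℝ, ∀ g, inner ℝ (l2Image hL f) (l2Image hL g) = ∑ m, a m * H g m := by
  let K : X2 L →ₗ[ℝ] ℝ := (innerSL ℝ (l2Image hL f)).toLinearMap.comp (l2Image hL)
  have hK : K ∈ Submodule.span ℝ (Set.range fun m => (LinearMap.proj m).comp H) := by
    -- A functional vanishing on the common kernel of finitely many functionals is their
    -- combination. Moving along such a g leaves the finite data term unchanged, so the norm of `L
    -- f` is minimal on that line.
    refine mem_span_of_iInf_ker_le_ker fun g hg => ?_
    have hHg : H g = 0 := by
      ext m
      exact (Submodule.mem_iInf _).1 hg m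
    change inner ℝ (l2Image hL f) (l2Image hL g) = 0
    refine inner_eq_zero_of_forall_norm_le fun t => ?_
    have h1 := hf (f + t • g)
    rw [cost_eq hL, cost_eq hL, map_add, map_smul, hHg, smul_zero, add_zero, map_add, map_smul,
      ENNReal.add_le_add_iff_left hfin,
      ENNReal.mul_le_mul_iff_right (by simpa using hlam) ENNReal.ofReal_ne_top] at h1
    have h2 := ENNReal.toReal_mono (ENNReal.pow_ne_top enorm_ne_top) h1
    rw [ENNReal.toReal_pow, ENNReal.toReal_pow, toReal_enorm, toReal_enorm] at h2
    exact le_of_sq_le_sq h2 (norm_nonneg _)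
  obtain ⟨a, ha⟩ := (Submodule.mem_span_range_iff_exists_fun ℝ).1 hK
  refine ⟨a, fun g => ?_⟩
  have h1 := LinearMap.congr_fun ha g
  simpa [K] using h1.symm

end Representer

end Tikhonov

end

/-! ### Assembly of the representer theorem -/

theorem theorem1
    (L : 𝓢'(ℝ, ℂ) →L[ℂ] 𝓢'(ℝ, ℂ)) (hL : SplineAdmissible L)
    (Lhat : ℝ → ℂ) (hLhat : IsFrequencyResponse L Lhat)
    (ρ : 𝓢'(ℝ, ℂ)) (hρ : IsGreenAdjointSelf L ρ)
    (N₀ : ℕ) (p : Module.Basis (Fin N₀) ℝ (nullSpace L))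
    (M : ℕ) (h : Fin M → 𝓢'(ℝ, ℂ)) (H : X2 L →ₗ[ℝ] (Fin M → ℝ))
    (hHh : IsGivenBy H h) (hHb : IsBoundedMeasurement p H)
    (hwell : ∀ q r : nullSpace L, H q = H r ↔ q = r)
    (E : (Fin M → ℝ) → (Fin M → ℝ) → ℝ≥0∞) (z : Fin M → ℝ)
    (hEconv : IsConvex (E z)) (hElsc : LowerSemicontinuous (E z)) (hEcoer : IsCoercive (E z))
    (hEfeas : ∃ f : X2 L, E z (H f) ≠ ⊤)
    (lam : ℝ) (hlam : 0 < lam) :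
    (∀ m, ∃ φ, IsBasisFunction L Lhat ρ (h m) (fun f => H f m) φ) ∧
    (∃ f, IsMinimizer (cost L H E z lam) f) ∧
    (IsStrictlyConvex (E z) → ∃! f, IsMinimizer (cost L H E z lam) f) ∧
    ∀ φ : Fin M → 𝓢'(ℝ, ℂ),
      (∀ m, IsBasisFunction L Lhat ρ (h m) (fun f => H f m) (φ m)) →
      ∀ f₂, IsMinimizer (cost L H E z lam) f₂ →
        ∃ (a : Fin M → ℝ) (b : Fin N₀ → ℝ),
          (f₂ : 𝓢'(ℝ, ℂ)) = ∑ m, a m • φ m + ∑ n, b n • ((p n : X2 L) : 𝓢'(ℝ, ℂ)) ∧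
          ∀ n, ∑ m, a m * H (p n) m = 0 := by
  have hreal := hL.real
  obtain ⟨T, hT⟩ := exists_isTranspose L
  obtain ⟨κ, hκr, hκ, C, hC⟩ := hHb
  have hbij := bijective_l2Image_prod_pairings hT hreal hLhat hρ p hκ
  obtain ⟨G, hG⟩ := exists_factorization hreal hbij hC
  have hinj (f : X2 L) (hf : l2Image hreal f = 0) (hHf : H f = 0) : f = 0 := by
    have h1 := (hwell ⟨f, (l2Image_eq_zero_iff hreal f).1 hf⟩ 0).1 (by simpa using hHf)
    exact congrArg Subtype.val h1
  have hGinj (k : Fin N₀ → ℝ) (hk : G (0, k) = 0) : k = 0 := by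
    obtain ⟨f, hf⟩ := hbij.surjective (0, k)
    obtain ⟨h1, h2⟩ := Prod.mk.inj hf
    have h3 : f = 0 := hinj f h1 (by
      rw [hG, h1]; exact (congrArg (fun k => G (0, k)) h2).trans hk)
    rw [← h2, h3]
    exact map_zero (pairings L κ)
  have hmin : ∃ f, IsMinimizer (cost L H E z lam) f := by
    obtain ⟨f₀, hf₀⟩ := hEfeas
    obtain ⟨x, hx⟩ := exists_minimizer_hilbert G hGinj hElsc hEcoer hlam
      (x₀ := (l2Image hreal f₀, pairings L κ f₀)) (by rwa [← hG])
    obtain ⟨f, rfl⟩ := hbij.surjective x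
    refine ⟨f, fun g => ?_⟩
    rw [cost_eq hreal, cost_eq hreal, hG, hG]
    exact hx (l2Image hreal g, pairings L κ g)
  refine ⟨fun m => ?_, hmin, fun hstrict => ?_, fun φ hφ f hf => ?_⟩
  · obtain ⟨f, c, hrep⟩ := exists_riesz hreal hbij hG m
    exact exists_isBasisFunction hT hreal hLhat hρ hκr (hHh m) hrep
  · obtain ⟨f, hf⟩ := hmin
    refine ⟨f, hf, fun g hg => ?_⟩
    refine eq_of_minimizers (l2Image hreal) H hstrict hlam (fun h1 h2 => ?_)
      (hg.ne_top hEfeas) (hf.ne_top hEfeas) (fun k => ?_) fun k => ?_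
    · rw [← sub_eq_zero]
      exact hinj _ (by rw [map_sub, h1, sub_self]) (by rw [map_sub, h2, sub_self])
    · rw [← cost_eq, ← cost_eq]
      exact hg k
    · rw [← cost_eq, ← cost_eq]
      exact hf k
  · obtain ⟨a, ha⟩ := hf.exists_inner_eq_sum hreal hlam (hf.ne_top hEfeas)
    have happly (ψ : 𝓢(ℝ, ℂ)) : ((f : 𝓢'(ℝ, ℂ)) - ∑ m, a m • φ m) ψ =
        (f : 𝓢'(ℝ, ℂ)) ψ - ∑ m, (a m : ℂ) * φ m ψ := by
      simp
    have hu : IsReal ((f : 𝓢'(ℝ, ℂ)) - ∑ m, a m • φ m) := by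
      intro ψ hψ
      rw [happly]
      simp [f.2.1 ψ hψ, (hφ _).real ψ hψ]
    -- The optimality identity at g = ρ^∨ * ψ has f(ψ) on the left by the reproducing property, and
    -- ∑ aₘφₘ(ψ) on the right by the duality defining φₘ.
    have hzero := eq_sum_of_forall_orthNull p hκr hκ hu fun ψ hψr hψ => by
      have hmem := correlate_mem_X2 hT hreal hLhat hρ hψr hψ
      rw [happly, apply_eq_inner_correlate hT hreal hLhat hρ hψr hψ hmem, ha, sub_eq_zero,
        Complex.ofReal_sum]
      refine Finset.sum_congr rfl fun m _ => ?_
      obtain ⟨_, h1⟩ := (hφ m).convolution ψ hψr hψ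
      rw [h1, Complex.ofReal_mul]
    refine ⟨a, _, sub_eq_iff_eq_add'.1 hzero, fun n => ?_⟩
    rw [← ha, (l2Image_eq_zero_iff hreal _).2 (p n).2, inner_zero_right]
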